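/- Let $(r_n)_{n\ge1}\subset(0,1/2)$, let $(m_n)_{n\ge1}$ be integers with $m_n\ge2$, and for each $n\ge 1$ let $D_n=\{d^n_1<\dots<d^n_{m_n}\}$ with $d^n_1=0$, $d^n_{m_n}=(1-r_n)/r_n$ and $d^n_{j+1}-d^n_j>1$ for $1\le j<m_n$. Put $\mu(n)=m_1\cdots m_n$ and $s_n=r_1\cdots r_n$. For a word $\sigma=\sigma_1\dots\sigma_n$ with $1\le\sigma_i\le m_i$ put $$a(\sigma)=\sum_{i=1}^n d^i_{\sigma_i}s_i,\qquad b(\sigma)=a(\sigma)+s_n,\qquad I_\sigma=[a(\sigma),b(\sigma)],$$ let $C_n$ be the union of the intervals $I_\sigma$ over all words $\sigma$ of length $n$, and let $C=\bigcap_{n\ge1}C_n$. The gaps of order $n$ have lengths $g^n_j=s_n(d^n_{j+1}-d^n_j-1)$, $1\le j\le m_n-1$. Let $$t=\limsup_{n\to\infty}\frac{\log\mu(n)}{|\log s_n|},$$ and define, with values in $[0,\infty]$, $$\alpha=\limsup_{n\to\infty}\ \max_{1\le k\le m_n-1}\frac{\mu(n)}{k}\Big(ks_n+\sum_{i=1}^kg^n_i\Big)^t,$$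 $$\beta=\limsup_{n\to\infty}\ \max_{2\le k\le m_n}\frac{\mu(n)}{m_n-k+1}\Big((m_n-k+1)s_n+\sum_{i=k-1}^{m_n-1}g^n_i\Big)^t.$$ Fix any infinite word $\tau=\tau_1\tau_2\dots$ with $1\le\tau_i\le m_i$. For $n$ with $m_n\ge3$ and $2\le k^1\le k^2\le m_n-1$ put $$a_n=b(\tau_1\dots\tau_{n-1}(k^1-1)),\qquad b_n=a(\tau_1\dots\tau_{n-1}(k^2+1)),\qquad d_n=\operatorname{dist}\Big(C,\frac{a_n+b_n}2\Big)$$ (these depend on $k^1,k^2$), and let $$\gamma=\limsup_{n\to\infty,\ m_n\ge3}\ \max_{2\le k^1\le k^2\le m_n-1}\frac{\mu(n)}{k^2-k^1+1}\,(b_n-a_n-2d_n)^t,$$ with $\gamma$ omitted from the maximum below (that is, $\gamma=0$) if $m_n\ge3$ for only finitely many $n$. Suppose that there are $M$ with $m_n\le M$ for all $n\ge1$ and $c>1$ with $d^n_{j+1}-d^n_j\ge c$ for all $n\ge1$ and $1\le j\le m_n-1$. Then the $t$-dimensional packing measure of $C$ is $$\mathcal P^t(C)=\max\{2^t\alpha,\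 2^t\beta,\ \gamma\}\in[0,\infty].$$ Here $\mathcal P^t(A)=\inf\{\sum_iP^t(A_i):A\subseteq\bigcup_{i\in\mathbb N}A_i\}$, where $P^t(A)=\lim_{\delta\to0}\sup\sum_i(2\rho_i)^t$, the supremum being over families of disjoint closed balls with centres in $A$, radii $\rho_i>0$ and diameters $2\rho_i\le\delta$. -/

import Mathlib

open Filter Set
open scoped ENNReal

/-! ### Packing measure on the real line -/

/-- `F` is a finite `δ`-packing of `A`: each `p ∈ F` encodes the closed ball with centre `p.1 ∈ A`
and radius `p.2 > 0`, the diameters `2 * p.2` are at most `δ`, and the balls are disjoint. -/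
def IsPacking (δ : ℝ) (A : Set ℝ) (F : Finset (ℝ × ℝ)) : Prop :=
  (∀ p ∈ F, p.1 ∈ A ∧ 0 < p.2 ∧ 2 * p.2 ≤ δ) ∧
    (F : Set (ℝ × ℝ)).PairwiseDisjoint fun p => Metric.closedBall p.1 p.2

/-- The supremum of `∑ (2 rᵢ) ^ t` over the `δ`-packings of `A`. (Countable packings give the same
supremum as finite ones.) -/
noncomputable def packingSup (t δ : ℝ) (A : Set ℝ) : ℝ≥0∞ :=
  ⨆ (F : Finset (ℝ × ℝ)) (_ : IsPacking δ A F), ∑ p ∈ F, ENNReal.ofReal ((2 * p.2) ^ t)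

/-- The `t`-dimensional packing premeasure: the (decreasing) limit of `packingSup t δ A` as
`δ` tends to `0`. -/
noncomputable def packingPremeasure (t : ℝ) (A : Set ℝ) : ℝ≥0∞ :=
  ⨅ (δ : ℝ) (_ : 0 < δ), packingSup t δ A

/-- The `t`-dimensional packing measure. -/
noncomputable def packingMeasure (t : ℝ) (A : Set ℝ) : ℝ≥0∞ :=
  ⨅ (S : ℕ → Set ℝ) (_ : A ⊆ ⋃ i, S i), ∑' i, packingPremeasure t (S i)

/-! ### The Cantor construction -/

/-- The data of the construction: ratios `r n`, numbers of children `m n` and digits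
`d n 1 < ⋯ < d n (m n)`, for the steps `n ≥ 1`. Values at other indices are irrelevant. -/
structure CantorData where
  r : ℕ → ℝ
  m : ℕ → ℕ
  d : ℕ → ℕ → ℝ
  r_pos : ∀ n, 1 ≤ n → 0 < r n
  r_lt_half : ∀ n, 1 ≤ n → r n < 1 / 2
  two_le_m : ∀ n, 1 ≤ n → 2 ≤ m n
  d_first : ∀ n, 1 ≤ n → d n 1 = 0
  d_last : ∀ n, 1 ≤ n → d n (m n) = (1 - r n) / r n
  one_lt_d_sub : ∀ n, 1 ≤ n → ∀ j, 1 ≤ j → j < m n → 1 < d n (j + 1) - d n j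

namespace CantorData

variable (K : CantorData)

/-- `s_n = r_1 ⋯ r_n`, the length of the basic intervals of order `n`. -/
noncomputable def s (n : ℕ) : ℝ := ∏ i ∈ Finset.Icc 1 n, K.r i

/-- `μ(n) = m_1 ⋯ m_n`, the number of basic intervals of order `n`. -/
def mu (n : ℕ) : ℕ := ∏ i ∈ Finset.Icc 1 n, K.m i

/-- Infinite words `w 1, w 2, …` with `1 ≤ w i ≤ m i`. -/
def IsWord (w : ℕ → ℕ) : Prop := ∀ i, 1 ≤ i → 1 ≤ w i ∧ w i ≤ K.m i

/-- Left endpoint of the basic interval of order `n` coded by the first `n` letters of `w`. -/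
noncomputable def left (n : ℕ) (w : ℕ → ℕ) : ℝ := ∑ i ∈ Finset.Icc 1 n, K.d i (w i) * K.s i

/-- Right endpoint of the basic interval of order `n` coded by the first `n` letters of `w`. -/
noncomputable def right (n : ℕ) (w : ℕ → ℕ) : ℝ := K.left n w + K.s n

/-- `C_n`, the union of the basic intervals of order `n`. -/
def stage (n : ℕ) : Set ℝ := ⋃ (w : ℕ → ℕ) (_ : K.IsWord w), Icc (K.left n w) (K.right n w)

/-- The Cantor set. -/
def cantorSet : Set ℝ := ⋂ (n : ℕ) (_ : 1 ≤ n), K.stage n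

/-- The length `g^n_j` of the `j`-th gap of order `n`, `1 ≤ j ≤ m_n - 1`. -/
noncomputable def gap (n j : ℕ) : ℝ := K.s n * (K.d n (j + 1) - K.d n j - 1)

/-- The packing dimension `t`. -/
noncomputable def dimP : ℝ :=
  limsup (fun n : ℕ => Real.log (K.mu n) / |Real.log (K.s n)|) atTop

/-- The left ratio `α_n`. -/
noncomputable def alphaSeq (n : ℕ) : ℝ≥0∞ :=
  ⨆ k ∈ Finset.Icc 1 (K.m n - 1), ENNReal.ofReal
    ((K.mu n : ℝ) / (k : ℝ) *
      ((k : ℝ) * K.s n + ∑ i ∈ Finset.Icc 1 k, K.gap n i) ^ K.dimP)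

/-- `α = limsup α_n`. -/
noncomputable def alpha : ℝ≥0∞ := limsup K.alphaSeq atTop

/-- The right ratio `β_n`. -/
noncomputable def betaSeq (n : ℕ) : ℝ≥0∞ :=
  ⨆ k ∈ Finset.Icc 2 (K.m n), ENNReal.ofReal
    ((K.mu n : ℝ) / ((K.m n : ℝ) - k + 1) *
      (((K.m n : ℝ) - k + 1) * K.s n +
        ∑ i ∈ Finset.Icc (k - 1) (K.m n - 1), K.gap n i) ^ K.dimP)

/-- `β = limsup β_n`. -/
noncomputable def beta : ℝ≥0∞ := limsup K.betaSeq atTop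

/-- `a_n`: the right endpoint of the basic interval of order `n` coded by
`τ 1, …, τ (n - 1), k₁ - 1`. -/
noncomputable def aPt (τ : ℕ → ℕ) (n k₁ : ℕ) : ℝ := K.right n (Function.update τ n (k₁ - 1))

/-- `b_n`: the left endpoint of the basic interval of order `n` coded by
`τ 1, …, τ (n - 1), k₂ + 1`. -/
noncomputable def bPt (τ : ℕ → ℕ) (n k₂ : ℕ) : ℝ := K.left n (Function.update τ n (k₂ + 1))

/-- `d_n`: the distance from the Cantor set to the midpoint of `[a_n, b_n]`. -/
noncomputable def midDist (τ : ℕ → ℕ) (n k₁ k₂ : ℕ) : ℝ :=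
  Metric.infDist ((K.aPt τ n k₁ + K.bPt τ n k₂) / 2) K.cantorSet

/-- The central ratio `γ_n`, for `m_n ≥ 3`: the maximum over `2 ≤ k₁ ≤ k₂ ≤ m_n - 1`. -/
noncomputable def gammaSeq (τ : ℕ → ℕ) (n : ℕ) : ℝ≥0∞ :=
  ⨆ k₁ ∈ Finset.Icc 2 (K.m n - 1), ⨆ k₂ ∈ Finset.Icc k₁ (K.m n - 1), ENNReal.ofReal
    ((K.mu n : ℝ) / ((k₂ : ℝ) - k₁ + 1) *
      (K.bPt τ n k₂ - K.aPt τ n k₁ - 2 * K.midDist τ n k₁ k₂) ^ K.dimP)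

/-- `γ`: the limsup of `γ_n` along the subsequence of those `n` with `m_n ≥ 3`. It is `0`, and so
does not count in a maximum, if there are only finitely many such `n`. -/
noncomputable def gamma (τ : ℕ → ℕ) : ℝ≥0∞ :=
  limsup (K.gammaSeq τ) (atTop ⊓ 𝓟 {n | 3 ≤ K.m n})

end CantorData

/-! Let ν (`cantorMeasure`) be the measure giving each basic interval of order n mass 1/μ(n). Both
inequalities compare (2ρ)^t with the ν-mass of closed balls B(x, ρ) centred in C. Of the exponent
only 0 ≤ t ≤ 1 enters: it makes u ↦ u^t subadditive, and t = 0 forces α = ∞.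

Upper bound. If H exceeds the maximum, then (2ρ)^t ≤ H ν(B(x, ρ)) for every x in C and all small ρ
(`two_mul_rpow_le`); summing over disjoint balls gives `packingMeasure_le`. Take the largest basic
interval around x that the ball contains, and its parent I. If the ball sticks out of I on one side,
it contains an end segment of I of length at least ρ, which α or β controls (`rpow_le_prefix`,
`rpow_le_suffix`). Otherwise γ controls the ball up to the nearer neighbouring child that it does
not contain, and any excess is an end segment of that child, controlled by α or β again.

Lower bound. If h is below one of the three numbers, ν-almost every point is the centre of
arbitrarily small balls with h ν(B) ≤ (2ρ)^t, and a Besicovitch covering gives h ≤ P^t(C)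
(`le_packingMeasure`). Such balls are centred near an end of a basic interval, or near a point of C
almost closest to a midpoint (a_n + b_n)/2, transported to another interval of the same order. Being
that near only prescribes a block of letters of fixed length, so m_n ≤ M and Borel–Cantelli make
almost every code meet such blocks infinitely often (`ae_frequently_block`). The uniform gaps from c
> 1 let one block length serve all orders. -/

namespace CantorData

variable (K : CantorData)

/-! ### Lengths, counts and spacing of digits -/

theorem s_zero : K.s 0 = 1 := by simp [s]

theorem s_succ (n : ℕ) : K.s (n + 1) = K.s n * K.r (n + 1) := by
  simp [s, Finset.prod_Icc_succ_top]

theorem s_pos (n : ℕ) : 0 < K.s n :=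
  Finset.prod_pos fun i hi => K.r_pos i (Finset.mem_Icc.1 hi).1

theorem s_succ_le (n : ℕ) : K.s (n + 1) ≤ K.s n / 2 := by
  rw [s_succ]
  have := K.r_lt_half (n + 1) (by omega)
  nlinarith [K.s_pos n]

theorem s_add_le (n l : ℕ) : K.s (n + l) ≤ K.s n / 2 ^ l := by
  induction l with
  | zero => simp
  | succ l ih =>
    refine (K.s_succ_le (n + l)).trans ?_
    rw [pow_succ, ← div_div]
    linarith

theorem s_antitone : Antitone K.s :=
  antitone_nat_of_succ_le fun n => (K.s_succ_le n).trans (by linarith [K.s_pos n])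

theorem tendsto_s : Tendsto K.s atTop (nhds 0) := by
  refine squeeze_zero (fun n => (K.s_pos n).le) (g := fun n : ℕ => (1 / 2 : ℝ) ^ n) (fun n => ?_)
    (tendsto_pow_atTop_nhds_zero_of_lt_one (by norm_num) (by norm_num))
  simpa [K.s_zero] using K.s_add_le 0 n

theorem mu_succ (n : ℕ) : K.mu (n + 1) = K.mu n * K.m (n + 1) := by
  simp [mu, Finset.prod_Icc_succ_top]

theorem mu_pos (n : ℕ) : 0 < K.mu n :=
  Finset.prod_pos fun i hi => by have := K.two_le_m i (Finset.mem_Icc.1 hi).1; omega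

theorem two_pow_le_mu (n : ℕ) : 2 ^ n ≤ K.mu n := by
  induction n with
  | zero => simp [mu]
  | succ n ih =>
    rw [mu_succ, pow_succ]
    exact Nat.mul_le_mul ih (K.two_le_m _ (by omega))

theorem left_succ (n : ℕ) (w : ℕ → ℕ) :
    K.left (n + 1) w = K.left n w + K.d (n + 1) (w (n + 1)) * K.s (n + 1) := by
  simp [left, Finset.sum_Icc_succ_top]

/-- The intervals of order `n` in terms of those of order `n + 1`. -/
theorem s_eq (n : ℕ) : K.s n = (K.d (n + 1) (K.m (n + 1)) + 1) * K.s (n + 1) := by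
  have h := K.r_pos (n + 1) (by omega)
  rw [K.d_last _ (by omega), s_succ]
  field_simp
  ring

variable {K}

theorem d_add_le {c : ℝ} (hc : 0 ≤ c) {n : ℕ}
    (hsep : ∀ j, 1 ≤ j → j < K.m n → c ≤ K.d n (j + 1) - K.d n j) {j k : ℕ} (hj : 1 ≤ j)
    (hjk : j < k) (hk : k ≤ K.m n) : K.d n j + c ≤ K.d n k := by
  induction k, hjk using Nat.le_induction with
  | base => linarith [hsep j hj (by omega)]
  | succ k hk' ih =>
    have h1 := ih (by omega)
    have h2 := hsep k (by omega) (by omega)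
    linarith

theorem d_add_one_lt {n : ℕ} (hn : 1 ≤ n) {j k : ℕ} (hj : 1 ≤ j) (hjk : j < k) (hk : k ≤ K.m n) :
    K.d n j + 1 < K.d n k := by
  induction k, hjk using Nat.le_induction with
  | base => linarith [K.one_lt_d_sub n hn j hj (by omega)]
  | succ k hk' ih =>
    have h1 := ih (by omega)
    have h2 := K.one_lt_d_sub n hn k (by omega) (by omega)
    linarith

theorem d_mono {n : ℕ} (hn : 1 ≤ n) {j k : ℕ} (hj : 1 ≤ j) (hjk : j ≤ k) (hk : k ≤ K.m n) :
    K.d n j ≤ K.d n k := by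
  rcases hjk.eq_or_lt with rfl | h
  · exact le_rfl
  · linarith [d_add_one_lt hn hj h hk]

theorem d_nonneg {n : ℕ} (hn : 1 ≤ n) {j : ℕ} (hj : 1 ≤ j) (hk : j ≤ K.m n) : 0 ≤ K.d n j := by
  simpa [K.d_first n hn] using d_mono hn le_rfl hj hk

theorem cast_le_d_add_one {n : ℕ} (hn : 1 ≤ n) {j : ℕ} (hj : 1 ≤ j) (hk : j ≤ K.m n) :
    (j : ℝ) ≤ K.d n j + 1 := by
  induction j, hj using Nat.le_induction with
  | base => simp [K.d_first n hn]
  | succ j hj ih =>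
    push_cast
    linarith [ih (by omega), K.one_lt_d_sub n hn j hj (by omega)]

-- The m_{n+1} children are disjoint inside their parent, so m_{n+1} s_{n+1} ≤ s_n. This is what
-- yields t ≤ 1.
variable (K) in
theorem mu_mul_s_le_one (n : ℕ) : K.mu n * K.s n ≤ 1 := by
  induction n with
  | zero => simp [mu, s]
  | succ n ih =>
    have h1 := cast_le_d_add_one (K := K) (n := n + 1) (by omega) (j := K.m (n + 1))
      (by have := K.two_le_m (n + 1) (by omega); omega) le_rfl
    refine le_trans ?_ ih
    rw [mu_succ, K.s_eq n]
    push_cast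
    rw [mul_assoc]
    gcongr
    exact (K.s_pos _).le

/-- A block of `k` children together with the gaps that follow them. -/
theorem sum_gap_Icc {n : ℕ} {j k : ℕ} (hjk : j ≤ k) :
    ((k - j : ℕ) : ℝ) * K.s n + ∑ i ∈ Finset.Ico j k, K.gap n i
      = (K.d n k - K.d n j) * K.s n := by
  have h : ∀ i ∈ Finset.Ico j k, K.gap n i = K.s n * (K.d n (i + 1) - K.d n i) - K.s n := by
    intro i _; simp only [gap]; ring
  rw [Finset.sum_congr rfl h, Finset.sum_sub_distrib, ← Finset.mul_sum,
    Finset.sum_Ico_sub _ hjk]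
  simp only [Finset.sum_const, Nat.card_Ico, nsmul_eq_mul]
  ring

/-! ### Words -/

/-- The words `w` and `w'` have the same first `n` letters. -/
def Agree (n : ℕ) (w w' : ℕ → ℕ) : Prop := ∀ i, 1 ≤ i → i ≤ n → w i = w' i

theorem Agree.symm {n : ℕ} {w w' : ℕ → ℕ} (h : Agree n w w') : Agree n w' w :=
  fun i hi hn => (h i hi hn).symm

theorem agree_update (n k : ℕ) (w : ℕ → ℕ) : Agree n w (Function.update w (n + 1) k) :=
  fun i _ hn => by rw [Function.update_of_ne (by omega)]

theorem Agree.left_eq {n : ℕ} {w w' : ℕ → ℕ} (h : Agree n w w') : K.left n w = K.left n w' :=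
  Finset.sum_congr rfl fun i hi => by
    rw [h i (Finset.mem_Icc.1 hi).1 (Finset.mem_Icc.1 hi).2]

theorem exists_first_difference {n : ℕ} {w w' : ℕ → ℕ} (h : ¬ Agree n w w') :
    ∃ i < n, Agree i w w' ∧ w (i + 1) ≠ w' (i + 1) := by
  induction n with
  | zero => exact absurd (fun i h1 h2 => by omega) h
  | succ n ih =>
    by_cases h' : Agree n w w'
    · refine ⟨n, by omega, h', fun he => h fun i h1 h2 => ?_⟩
      rcases h2.eq_or_lt with rfl | h3
      · exact he
      · exact h' i h1 (by omega)
    · obtain ⟨i, hi, h1⟩ := ih h'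
      exact ⟨i, by omega, h1⟩

theorem left_update (n k : ℕ) (w : ℕ → ℕ) :
    K.left (n + 1) (Function.update w (n + 1) k) = K.left n w + K.d (n + 1) k * K.s (n + 1) := by
  rw [left_succ, ← (agree_update n k w).left_eq, Function.update_self]

theorem IsWord.update {w : ℕ → ℕ} (hw : K.IsWord w) {n k : ℕ} (h1 : 1 ≤ k) (hk : k ≤ K.m n) :
    K.IsWord (Function.update w n k) := by
  intro i hi
  by_cases h : i = n
  · subst h; simpa using ⟨h1, hk⟩
  · rw [Function.update_of_ne h]; exact hw i hi

theorem IsWord.left_le_left_succ {w : ℕ → ℕ} (hw : K.IsWord w) (n : ℕ) :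
    K.left n w ≤ K.left (n + 1) w := by
  rw [left_succ]
  have := d_nonneg (K := K) (n := n + 1) (by omega) (hw _ (by omega)).1 (hw _ (by omega)).2
  nlinarith [K.s_pos (n + 1)]

theorem IsWord.right_succ_le_right {w : ℕ → ℕ} (hw : K.IsWord w) (n : ℕ) :
    K.right (n + 1) w ≤ K.right n w := by
  rw [right, right, left_succ, K.s_eq n]
  have := d_mono (K := K) (n := n + 1) (by omega) (hw _ (by omega)).1 (hw _ (by omega)).2 le_rfl
  nlinarith [K.s_pos (n + 1)]

theorem IsWord.left_mono {w : ℕ → ℕ} (hw : K.IsWord w) : Monotone fun n => K.left n w :=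
  monotone_nat_of_le_succ hw.left_le_left_succ

theorem IsWord.right_antitone {w : ℕ → ℕ} (hw : K.IsWord w) : Antitone fun n => K.right n w :=
  antitone_nat_of_succ_le hw.right_succ_le_right

theorem left_le_right (n : ℕ) (w : ℕ → ℕ) : K.left n w ≤ K.right n w := by
  rw [right]; linarith [K.s_pos n]

theorem IsWord.left_le_right' {w : ℕ → ℕ} (hw : K.IsWord w) (n k : ℕ) :
    K.left n w ≤ K.right k w :=
  (hw.left_mono (le_max_left n k)).trans <| (left_le_right _ _).trans <|
    hw.right_antitone (le_max_right n k)

/-- Basic intervals whose codes first differ at the letter `i + 1` are separated. -/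
theorem right_lt_left {i : ℕ} {w w' : ℕ → ℕ} (hw : K.IsWord w) (hw' : K.IsWord w')
    (h : Agree i w w') (hlt : w (i + 1) < w' (i + 1)) :
    K.right (i + 1) w < K.left (i + 1) w' := by
  rw [right, left_succ, left_succ, h.left_eq]
  have := d_add_one_lt (K := K) (n := i + 1) (by omega) (hw _ (by omega)).1 hlt
    (hw' _ (by omega)).2
  nlinarith [K.s_pos (i + 1)]

theorem right_add_le_left {c : ℝ} (hc : 0 ≤ c)
    (hsep : ∀ n, 1 ≤ n → ∀ j, 1 ≤ j → j < K.m n → c ≤ K.d n (j + 1) - K.d n j)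
    {i : ℕ} {w w' : ℕ → ℕ} (hw : K.IsWord w) (hw' : K.IsWord w')
    (h : Agree i w w') (hlt : w (i + 1) < w' (i + 1)) :
    K.right (i + 1) w + (c - 1) * K.s (i + 1) ≤ K.left (i + 1) w' := by
  rw [right, left_succ, left_succ, h.left_eq]
  have := d_add_le hc (hsep (i + 1) (by omega)) (hw _ (by omega)).1 hlt (hw' _ (by omega)).2
  nlinarith [K.s_pos (i + 1)]

theorem agree_of_mem {n : ℕ} {w w' : ℕ → ℕ} (hw : K.IsWord w) (hw' : K.IsWord w') {x : ℝ}
    (hx : x ∈ Icc (K.left n w) (K.right n w)) (hx' : x ∈ Icc (K.left n w') (K.right n w')) :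
    Agree n w w' := by
  by_contra h
  obtain ⟨i, hi, hag, hne⟩ := exists_first_difference h
  have h1 := hw.left_mono (show i + 1 ≤ n by omega)
  have h2 := hw'.left_mono (show i + 1 ≤ n by omega)
  have h3 := hw.right_antitone (show i + 1 ≤ n by omega)
  have h4 := hw'.right_antitone (show i + 1 ≤ n by omega)
  simp only at h1 h2 h3 h4
  rcases hne.lt_or_gt with hlt | hlt
  · linarith [right_lt_left hw hw' hag hlt, hx.2, hx'.1]
  · linarith [right_lt_left hw' hw hag.symm hlt, hx'.2, hx.1]

/-- `w` is a code of the point `x`. -/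
def Codes (K : CantorData) (w : ℕ → ℕ) (x : ℝ) : Prop :=
  K.IsWord w ∧ ∀ n, x ∈ Icc (K.left n w) (K.right n w)

theorem Codes.mem_cantorSet {w : ℕ → ℕ} {x : ℝ} (h : K.Codes w x) : x ∈ K.cantorSet := by
  simp only [cantorSet, stage, mem_iInter, mem_iUnion]
  exact fun n _ => ⟨w, h.1, h.2 n⟩

/-- Words chosen separately at each order are compatible, because distinct basic intervals of one
order are disjoint; the diagonal word is therefore a code. -/
theorem exists_codes {x : ℝ} (hx : x ∈ K.cantorSet) : ∃ w, K.Codes w x := by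
  simp only [cantorSet, stage, mem_iInter, mem_iUnion] at hx
  have hx' : ∀ n : ℕ, ∃ w, K.IsWord w ∧ x ∈ Icc (K.left n w) (K.right n w) := by
    intro n
    obtain ⟨w, hw, h1, h2⟩ := hx (n + 1) (by omega)
    exact ⟨w, hw, (hw.left_le_left_succ n).trans h1, h2.trans (hw.right_succ_le_right n)⟩
  choose w hw hxw using hx'
  have hag : ∀ n, Agree n (fun i => w i i) (w n) := by
    intro n i hi hn
    exact agree_of_mem (hw i) (hw n) (hxw i)
      ⟨((hw n).left_mono hn).trans (hxw n).1, (hxw n).2.trans ((hw n).right_antitone hn)⟩ i hi le_rfl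
  refine ⟨fun i => w i i, fun i hi => hw i i hi, fun n => ?_⟩
  rw [right, (hag n).left_eq]
  exact hxw n

/-- The point of the Cantor set coded by a word. -/
noncomputable def point (K : CantorData) (w : ℕ → ℕ) : ℝ := ⨆ n, K.left n w

theorem IsWord.codes_point {w : ℕ → ℕ} (hw : K.IsWord w) : K.Codes w (K.point w) := by
  refine ⟨hw, fun n => ⟨?_, ?_⟩⟩
  · exact le_ciSup (f := fun n => K.left n w)
      ⟨K.right 0 w, by rintro _ ⟨n, rfl⟩; exact hw.left_le_right' n 0⟩ n
  · exact ciSup_le fun k => hw.left_le_right' k n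

theorem isWord_one : K.IsWord fun _ => 1 := fun i hi =>
  ⟨le_rfl, one_le_two.trans (K.two_le_m i hi)⟩

theorem isWord_m : K.IsWord K.m := fun i hi =>
  ⟨by have := K.two_le_m i hi; omega, le_rfl⟩

/-! ### The natural measure -/

open MeasureTheory ProbabilityTheory

variable (K)

/-- The uniform distribution on the letters `1, …, m_i`. -/
noncomputable def letterMeasure (i : ℕ) : Measure ℕ :=
  -- The maximum keeps the set nonempty at the irrelevant index 0, where `K.m 0` may vanish.
  uniformOn (Finset.Icc 1 (max 1 (K.m i)) : Finset ℕ)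

instance (i : ℕ) : IsProbabilityMeasure (K.letterMeasure i) :=
  isProbabilityMeasure_uniformOn (Finset.finite_toSet _) ⟨1, by simp⟩

/-- The law of a random word with independent uniform letters. -/
noncomputable def wordMeasure : Measure (ℕ → ℕ) := Measure.infinitePi K.letterMeasure

instance : IsProbabilityMeasure K.wordMeasure := by unfold wordMeasure; infer_instance

/-- The natural probability measure on the Cantor set. -/
noncomputable def cantorMeasure : Measure ℝ := K.wordMeasure.map K.point

variable {K}

theorem letterMeasure_apply {i : ℕ} (hi : 1 ≤ i) {B : Finset ℕ} (hB : B ⊆ Finset.Icc 1 (K.m i)) :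
    K.letterMeasure i B = (B.card : ℝ≥0∞) / K.m i := by
  have h : max 1 (K.m i) = K.m i := max_eq_right (one_le_two.trans (K.two_le_m i hi))
  rw [letterMeasure, uniformOn_apply_finset, h, Finset.inter_eq_right.2 hB]
  simp

theorem measurable_point : Measurable K.point := by
  refine Measurable.iSup fun n => ?_
  refine Finset.measurable_sum _ fun i _ => ?_
  exact (measurable_from_nat.comp (measurable_pi_apply i)).mul_const _

instance : IsProbabilityMeasure K.cantorMeasure :=
  Measure.isProbabilityMeasure_map measurable_point.aemeasurable

theorem ae_isWord : ∀ᵐ w ∂K.wordMeasure, K.IsWord w := by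
  refine ae_all_iff.2 fun i => ?_
  by_cases hi : 1 ≤ i
  · have h : K.wordMeasure {w | w i ∈ Finset.Icc 1 (K.m i)} = 1 := by
      have h2 := Measure.infinitePi_pi (μ := K.letterMeasure) (s := {i})
        (t := fun i => (Finset.Icc 1 (K.m i) : Finset ℕ)) (fun _ _ => Finset.measurableSet _)
      rw [Finset.prod_singleton, letterMeasure_apply hi subset_rfl] at h2
      have hm : K.m i ≠ 0 := by have := K.two_le_m i hi; omega
      rw [wordMeasure]
      convert h2 using 1
      · congr 1; ext w; simp
      · simp only [Nat.card_Icc, add_tsub_cancel_right]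
        rw [ENNReal.div_self (by exact_mod_cast hm) (ENNReal.natCast_ne_top _)]
    have hms : MeasurableSet {w : ℕ → ℕ | w i ∈ Finset.Icc 1 (K.m i)} :=
      (measurable_pi_apply i) (Finset.measurableSet (Finset.Icc 1 (K.m i)))
    filter_upwards [(mem_ae_iff_prob_eq_one hms).2 h] with w hw _
    simpa using hw
  · exact Eventually.of_forall fun w h => absurd h hi

/-- The words that agree with `w` up to order `n` and whose next letter is in `[k₁, k₂]`. -/
def cylinder (n : ℕ) (w : ℕ → ℕ) (k₁ k₂ : ℕ) : Set (ℕ → ℕ) :=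
  {w' | Agree n w w' ∧ w' (n + 1) ∈ Icc k₁ k₂}

theorem wordMeasure_cylinder {n : ℕ} {w : ℕ → ℕ} (hw : K.IsWord w) {k₁ k₂ : ℕ} (h1 : 1 ≤ k₁)
    (h12 : k₁ ≤ k₂) (h2 : k₂ ≤ K.m (n + 1)) :
    K.wordMeasure.real (cylinder n w k₁ k₂) = ((k₂ : ℝ) - k₁ + 1) / K.mu (n + 1) := by
  let t : ℕ → Finset ℕ := fun i => if i = n + 1 then Finset.Icc k₁ k₂ else {w i}
  have ht : ∀ i ∈ Finset.Icc 1 (n + 1), t i ⊆ Finset.Icc 1 (K.m i) := by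
    intro i hi
    rw [Finset.mem_Icc] at hi
    by_cases h : i = n + 1
    · subst h; simp only [t, if_true]; exact Finset.Icc_subset_Icc h1 h2
    · simp only [t, if_neg h, Finset.singleton_subset_iff, Finset.mem_Icc]; exact hw i hi.1
  have key := Measure.infinitePi_pi (μ := K.letterMeasure) (s := Finset.Icc 1 (n + 1))
    (t := fun i => (t i : Set ℕ)) (fun _ _ => Finset.measurableSet _)
  have hset : Set.pi (Finset.Icc 1 (n + 1) : Finset ℕ) (fun i => (t i : Set ℕ))
      = cylinder n w k₁ k₂ := by
    ext w'
    simp only [Set.mem_pi, cylinder, mem_ofPred_eq, Agree, Finset.coe_Icc, mem_Icc]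
    constructor
    · intro h
      refine ⟨fun i hi hn => ?_, ?_⟩
      · have := h i ⟨hi, by omega⟩
        simp only [t, if_neg (show i ≠ n + 1 by omega), Finset.coe_singleton,
          mem_singleton_iff] at this
        exact this.symm
      · simpa [t] using h (n + 1) ⟨by omega, le_rfl⟩
    · rintro ⟨ha, hb⟩ i ⟨hi, hn⟩
      by_cases h : i = n + 1
      · subst h; simpa [t] using hb
      · simp only [t, if_neg h, Finset.coe_singleton, mem_singleton_iff]
        exact (ha i hi (by omega)).symm
  rw [hset] at key
  rw [Measure.real, wordMeasure, key, ENNReal.toReal_prod]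
  have h3 : ∀ i ∈ Finset.Icc 1 (n + 1),
      (K.letterMeasure i (t i)).toReal = ((t i).card : ℝ) / K.m i := by
    intro i hi
    rw [letterMeasure_apply (Finset.mem_Icc.1 hi).1 (ht i hi)]
    simp
  rw [Finset.prod_congr rfl h3, Finset.prod_div_distrib, mu]
  push_cast
  congr 1
  rw [Finset.prod_Icc_succ_top (by omega), Finset.prod_eq_one, one_mul]
  · simp only [t, if_true, Nat.card_Icc]
    rw [Nat.cast_sub (by omega)]; push_cast; ring
  · intro i hi
    rw [Finset.mem_Icc] at hi
    simp [t, if_neg (show i ≠ n + 1 by omega)]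

/-- Only coded points of the set need checking, since almost every sequence is a word. -/
theorem cantorMeasure_le {n : ℕ} {w : ℕ → ℕ} (hw : K.IsWord w) {k₁ k₂ : ℕ} (h1 : 1 ≤ k₁)
    (h12 : k₁ ≤ k₂) (h2 : k₂ ≤ K.m (n + 1)) {S : Set ℝ} (hS : MeasurableSet S)
    (h : ∀ w', K.IsWord w' → K.point w' ∈ S → Agree n w w' ∧ w' (n + 1) ∈ Icc k₁ k₂) :
    K.cantorMeasure.real S ≤ ((k₂ : ℝ) - k₁ + 1) / K.mu (n + 1) := by
  rw [← wordMeasure_cylinder hw h1 h12 h2, Measure.real, Measure.real, cantorMeasure,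
    Measure.map_apply measurable_point hS]
  refine ENNReal.toReal_mono (measure_ne_top _ _) (measure_mono_ae ?_)
  filter_upwards [ae_isWord] with w' hw' hx using h w' hw' hx

theorem le_cantorMeasure {n : ℕ} {w : ℕ → ℕ} (hw : K.IsWord w) {k₁ k₂ : ℕ} (h1 : 1 ≤ k₁)
    (h12 : k₁ ≤ k₂) (h2 : k₂ ≤ K.m (n + 1)) :
    ((k₂ : ℝ) - k₁ + 1) / K.mu (n + 1) ≤ K.cantorMeasure.real
      (Icc (K.left n w + K.d (n + 1) k₁ * K.s (n + 1))
        (K.left n w + (K.d (n + 1) k₂ + 1) * K.s (n + 1))) := by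
  rw [← wordMeasure_cylinder hw h1 h12 h2, Measure.real, Measure.real, cantorMeasure,
    Measure.map_apply measurable_point measurableSet_Icc]
  refine ENNReal.toReal_mono (measure_ne_top _ _) (measure_mono_ae ?_)
  filter_upwards [ae_isWord] with w' hw' hx
  obtain ⟨hag, hk⟩ := hx
  have h := hw'.codes_point.2 (n + 1)
  rw [right, left_succ, ← hag.left_eq] at h
  have ha := d_mono (K := K) (n := n + 1) (by omega) h1 hk.1 (hk.2.trans h2)
  have hb := d_mono (K := K) (n := n + 1) (by omega) (h1.trans hk.1) hk.2 h2
  have hs := K.s_pos (n + 1)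
  exact ⟨by nlinarith [h.1], by nlinarith [h.2]⟩

/-! ### Mass of end segments of basic intervals -/

theorem measureReal_add_le {μ : Measure ℝ} [IsFiniteMeasure μ] {a b c d a' d' : ℝ} (hbc : b < c)
    (ha : a' ≤ a) (hb : b ≤ d') (hc : a' ≤ c) (hd : d ≤ d') :
    μ.real (Icc a b) + μ.real (Icc c d) ≤ μ.real (Icc a' d') := by
  rw [← measureReal_union ?_ measurableSet_Icc]
  · exact measureReal_mono (union_subset (Icc_subset_Icc ha hb) (Icc_subset_Icc hc hd))
  · rw [Set.disjoint_left]
    exact fun x hx hx' => by linarith [hx.2, hx'.1]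

theorem exists_last_le {m : ℕ} (hm : 1 ≤ m) {f : ℕ → ℝ} {y : ℝ} (h : f 1 ≤ y) :
    ∃ k, 1 ≤ k ∧ k ≤ m ∧ f k ≤ y ∧ (k < m → y < f (k + 1)) := by
  induction m, hm using Nat.le_induction with
  | base => exact ⟨1, le_rfl, le_rfl, h, fun h => absurd h (lt_irrefl _)⟩
  | succ m hm ih =>
    obtain ⟨k, h1, h2, h3, h4⟩ := ih
    rcases h2.eq_or_lt with rfl | h5
    · by_cases h6 : f (k + 1) ≤ y
      · exact ⟨k + 1, by omega, le_rfl, h6, fun h => absurd h (lt_irrefl _)⟩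
      · exact ⟨k, h1, by omega, h3, fun _ => not_le.1 h6⟩
    · exact ⟨k, h1, by omega, h3, fun _ => h4 h5⟩

/-- Induction on the number `j` of levels descended. A segment ending in the gap after child `k` is
handled by the α-bound for the first `k` children. One ending inside child `k` splits into the
stretch before that child, bounded by α with `k - 1` children, and an initial segment of the child;
subadditivity of the power adds the two. The last term is the error left on stopping. -/
theorem rpow_le_prefix_add {t A : ℝ} (ht0 : 0 < t) (ht1 : t ≤ 1) (hA : 0 ≤ A) {N : ℕ}
    (hα : ∀ n, N ≤ n → ∀ k, 1 ≤ k → k < K.m (n + 1) →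
      (K.d (n + 1) (k + 1) * K.s (n + 1)) ^ t ≤ A * (k / K.mu (n + 1))) (j : ℕ) :
    ∀ n, N ≤ n → ∀ w, K.IsWord w → ∀ y, 0 ≤ y → y ≤ K.s n →
      y ^ t ≤ A * K.cantorMeasure.real (Icc (K.left n w) (K.left n w + y)) + K.s (n + j) ^ t := by
  induction j with
  | zero =>
    intro n _ w _ y hy hys
    have h1 : y ^ t ≤ K.s n ^ t := Real.rpow_le_rpow hy hys ht0.le
    have h2 : 0 ≤ A * K.cantorMeasure.real (Icc (K.left n w) (K.left n w + y)) :=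
      mul_nonneg hA measureReal_nonneg
    simpa using by linarith
  | succ j ih =>
    intro n hn w hw y hy hys
    have hm := K.two_le_m (n + 1) (by omega)
    have hs := K.s_pos (n + 1)
    have hd1 := K.d_first (n + 1) (by omega)
    obtain ⟨k, hk1, hkm, hky, hky'⟩ := exists_last_le (m := K.m (n + 1)) (by omega)
      (f := fun k => K.d (n + 1) k * K.s (n + 1)) (y := y) (by simpa [hd1] using hy)
    have hst : 0 ≤ K.s (n + (j + 1)) ^ t := Real.rpow_nonneg (K.s_pos _).le _
    -- The segment contains all of child `k` and stops before child `k + 1`.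
    by_cases hcase : K.d (n + 1) k * K.s (n + 1) + K.s (n + 1) ≤ y ∧ k < K.m (n + 1)
    · have h1 : y ^ t ≤ A * (k / K.mu (n + 1)) :=
        (Real.rpow_le_rpow hy (hky' hcase.2).le ht0.le).trans (hα n hn k hk1 hcase.2)
      have h2 := le_cantorMeasure hw le_rfl hk1 hkm
      have h3 : K.cantorMeasure.real (Icc (K.left n w + K.d (n + 1) 1 * K.s (n + 1))
        (K.left n w + (K.d (n + 1) k + 1) * K.s (n + 1))) ≤
          K.cantorMeasure.real (Icc (K.left n w) (K.left n w + y)) :=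
        measureReal_mono (Icc_subset_Icc (by simp [hd1]) (by linarith [hcase.1]))
      have h4 : ((k : ℝ) - (1 : ℕ) + 1) / K.mu (n + 1) = k / K.mu (n + 1) := by
        congr 1; push_cast; ring
      rw [h4] at h2
      have := mul_le_mul_of_nonneg_left (h2.trans h3) hA
      linarith
    · have hlam : y - K.d (n + 1) k * K.s (n + 1) ≤ K.s (n + 1) := by
        by_contra hcon
        have : k = K.m (n + 1) := by
          by_contra hne
          exact hcase ⟨by linarith, by omega⟩
        rw [this] at hcon
        linarith [K.s_eq n]
      have hw' := hw.update (n := n + 1) hk1 hkm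
      have h1 := ih (n + 1) (by omega) _ hw' (y - K.d (n + 1) k * K.s (n + 1)) (by linarith) hlam
      rw [left_update, show n + 1 + j = n + (j + 1) by ring] at h1
      have hdk := d_nonneg (K := K) (n := n + 1) (by omega) hk1 hkm
      have h2 : y ^ t ≤ (K.d (n + 1) k * K.s (n + 1)) ^ t
          + (y - K.d (n + 1) k * K.s (n + 1)) ^ t := by
        have := Real.rpow_add_le_add_rpow (p := t) (mul_nonneg hdk hs.le) (sub_nonneg.2 hky)
          ht0.le ht1
        simpa using this
      rcases hk1.eq_or_lt with rfl | hk2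
      · rw [hd1] at h1 h2
        simp only [zero_mul, add_zero, sub_zero, Real.zero_rpow ht0.ne', zero_add] at h1 h2
        exact h1
      · obtain ⟨i, rfl⟩ : ∃ i, k = i + 1 := ⟨k - 1, by omega⟩
        have h3 := hα n hn i (by omega) (by omega)
        have h4 := le_cantorMeasure hw le_rfl (show 1 ≤ i by omega) (show i ≤ K.m (n + 1) by omega)
        have h4' : ((i : ℝ) - (1 : ℕ) + 1) / K.mu (n + 1) = i / K.mu (n + 1) := by
          congr 1; push_cast; ring
        rw [h4', hd1, zero_mul, add_zero] at h4
        have hlt := d_add_one_lt (K := K) (n := n + 1) (by omega) (show 1 ≤ i by omega)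
          (show i < i + 1 by omega) (by omega)
        have h5 := measureReal_add_le (μ := K.cantorMeasure) (a := K.left n w)
          (b := K.left n w + (K.d (n + 1) i + 1) * K.s (n + 1))
          (c := K.left n w + K.d (n + 1) (i + 1) * K.s (n + 1))
          (d := K.left n w + K.d (n + 1) (i + 1) * K.s (n + 1) +
            (y - K.d (n + 1) (i + 1) * K.s (n + 1)))
          (a' := K.left n w) (d' := K.left n w + y) (by nlinarith) le_rfl (by nlinarith)
          (by nlinarith) (by linarith)
        have h6 := mul_le_mul_of_nonneg_left h4 hA
        have h7 := mul_le_mul_of_nonneg_left h5 hA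
        rw [mul_add] at h7
        linarith

theorem le_of_forall_le_add_rpow_s {t a b : ℝ} (ht : 0 < t) {n : ℕ}
    (h : ∀ j, a ≤ b + K.s (n + j) ^ t) : a ≤ b := by
  have h1 : Tendsto (fun j => K.s (n + j)) atTop (nhds 0) := by
    simpa [add_comm] using (tendsto_add_atTop_iff_nat n).2 K.tendsto_s
  have h2 : Tendsto (fun j => b + K.s (n + j) ^ t) atTop (nhds b) := by
    simpa [Real.zero_rpow ht.ne'] using (h1.rpow_const (Or.inr ht.le)).const_add b
  exact ge_of_tendsto' h2 h

/-- The measure of an initial segment of a basic interval. -/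
theorem rpow_le_prefix {t A : ℝ} (ht0 : 0 < t) (ht1 : t ≤ 1) (hA : 0 ≤ A) {N : ℕ}
    (hα : ∀ n, N ≤ n → ∀ k, 1 ≤ k → k < K.m (n + 1) →
      (K.d (n + 1) (k + 1) * K.s (n + 1)) ^ t ≤ A * (k / K.mu (n + 1)))
    {n : ℕ} (hn : N ≤ n) {w : ℕ → ℕ} (hw : K.IsWord w) {y : ℝ} (hy : 0 ≤ y) (hys : y ≤ K.s n) :
    y ^ t ≤ A * K.cantorMeasure.real (Icc (K.left n w) (K.left n w + y)) :=
  le_of_forall_le_add_rpow_s ht0 fun j => rpow_le_prefix_add ht0 ht1 hA hα j n hn w hw y hy hys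

theorem right_update (n k : ℕ) (w : ℕ → ℕ) :
    K.right (n + 1) (Function.update w (n + 1) k)
      = K.left n w + (K.d (n + 1) k + 1) * K.s (n + 1) := by
  rw [right, left_update]; ring

theorem exists_first_ge {m : ℕ} (hm : 1 ≤ m) {f : ℕ → ℝ} {y : ℝ} (h : y ≤ f m) :
    ∃ k, 1 ≤ k ∧ k ≤ m ∧ y ≤ f k ∧ (1 < k → f (k - 1) < y) := by
  induction m, hm using Nat.le_induction with
  | base => exact ⟨1, le_rfl, le_rfl, h, fun h => absurd h (lt_irrefl _)⟩
  | succ m hm ih =>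
    by_cases h6 : y ≤ f m
    · obtain ⟨k, h1, h2, h3⟩ := ih h6
      exact ⟨k, h1, by omega, h3⟩
    · exact ⟨m + 1, by omega, le_rfl, h, fun _ => not_le.1 h6⟩

/-- Mirror image of `rpow_le_prefix_add`. In the hypothesis `k` is the last child left out, so it is
one less than the index in `betaSeq`. -/
theorem rpow_le_suffix_add {t A : ℝ} (ht0 : 0 < t) (ht1 : t ≤ 1) (hA : 0 ≤ A) {N : ℕ}
    (hβ : ∀ n, N ≤ n → ∀ k, 1 ≤ k → k < K.m (n + 1) →
      (K.s n - (K.d (n + 1) k + 1) * K.s (n + 1)) ^ t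
        ≤ A * ((K.m (n + 1) - k) / K.mu (n + 1))) (j : ℕ) :
    ∀ n, N ≤ n → ∀ w, K.IsWord w → ∀ y, 0 ≤ y → y ≤ K.s n →
      y ^ t ≤ A * K.cantorMeasure.real (Icc (K.right n w - y) (K.right n w))
        + K.s (n + j) ^ t := by
  induction j with
  | zero =>
    intro n _ w _ y hy hys
    have h1 : y ^ t ≤ K.s n ^ t := Real.rpow_le_rpow hy hys ht0.le
    have h2 : 0 ≤ A * K.cantorMeasure.real (Icc (K.right n w - y) (K.right n w)) :=
      mul_nonneg hA measureReal_nonneg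
    simpa using by linarith
  | succ j ih =>
    intro n hn w hw y hy hys
    have hm := K.two_le_m (n + 1) (by omega)
    have hs := K.s_pos (n + 1)
    have hd1 := K.d_first (n + 1) (by omega)
    have hsn := K.s_eq n
    have hr : K.right n w = K.left n w + K.s n := rfl
    obtain ⟨k, hk1, hkm, hky, hky'⟩ := exists_first_ge (m := K.m (n + 1)) (by omega)
      (f := fun k => (K.d (n + 1) k + 1) * K.s (n + 1)) (y := K.s n - y) (by linarith)
    have hst : 0 ≤ K.s (n + (j + 1)) ^ t := Real.rpow_nonneg (K.s_pos _).le _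
    by_cases hcase : K.s n - y ≤ K.d (n + 1) k * K.s (n + 1) ∧ 1 < k
    · obtain ⟨i, rfl⟩ : ∃ i, k = i + 1 := ⟨k - 1, by omega⟩
      have hi := hky' hcase.2
      rw [Nat.add_sub_cancel] at hi
      have h1 : y ^ t ≤ A * ((K.m (n + 1) - i) / K.mu (n + 1)) :=
        (Real.rpow_le_rpow hy (by linarith) ht0.le).trans (hβ n hn i (by omega) (by omega))
      have h2 := le_cantorMeasure hw hk1 hkm le_rfl
      rw [← hsn] at h2
      have h3 : K.cantorMeasure.real (Icc (K.left n w + K.d (n + 1) (i + 1) * K.s (n + 1))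
        (K.left n w + K.s n)) ≤
          K.cantorMeasure.real (Icc (K.right n w - y) (K.right n w)) :=
        measureReal_mono (Icc_subset_Icc (by linarith [hcase.1]) hr.ge)
      have h4 : ((K.m (n + 1) : ℝ) - (i + 1 : ℕ) + 1) / K.mu (n + 1)
          = (K.m (n + 1) - i) / K.mu (n + 1) := by
        congr 1; push_cast; ring
      rw [h4] at h2
      have := mul_le_mul_of_nonneg_left (h2.trans h3) hA
      linarith
    · set lam := (K.d (n + 1) k + 1) * K.s (n + 1) - (K.s n - y) with hlam_def
      have hlam : lam ≤ K.s (n + 1) := by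
        by_contra hcon
        have : k = 1 := by
          by_contra hne
          exact hcase ⟨by linarith, by omega⟩
        rw [hlam_def, this, hd1] at hcon
        linarith
      have hw' := hw.update (n := n + 1) hk1 hkm
      have h1 := ih (n + 1) (by omega) _ hw' lam (by linarith) hlam
      rw [right_update, show n + 1 + j = n + (j + 1) by ring] at h1
      have hdk := d_mono (K := K) (n := n + 1) (by omega) hk1 hkm le_rfl
      have hrest : 0 ≤ K.s n - (K.d (n + 1) k + 1) * K.s (n + 1) := by
        rw [hsn]; nlinarith
      have h2 : y ^ t ≤ (K.s n - (K.d (n + 1) k + 1) * K.s (n + 1)) ^ t + lam ^ t := by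
        have := Real.rpow_add_le_add_rpow (p := t) hrest (show 0 ≤ lam by linarith) ht0.le ht1
        convert this using 2
        rw [hlam_def]; ring
      rcases hkm.eq_or_lt with rfl | hk2
      · rw [hsn, sub_self, Real.zero_rpow ht0.ne'] at h2
        rw [hr]
        have e : K.left n w + K.s n - y
            = K.left n w + (K.d (n + 1) (K.m (n + 1)) + 1) * K.s (n + 1) - lam := by
          rw [hlam_def]; ring
        rw [e, hsn]
        linarith
      · have h3 := hβ n hn k hk1 hk2
        have h4 := le_cantorMeasure hw (show 1 ≤ k + 1 by omega) hk2 le_rfl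
        have h4' : ((K.m (n + 1) : ℝ) - (k + 1 : ℕ) + 1) / K.mu (n + 1)
            = (K.m (n + 1) - k) / K.mu (n + 1) := by
          congr 1; push_cast; ring
        rw [h4', ← hsn] at h4
        have hlt := d_add_one_lt (K := K) (n := n + 1) (by omega) hk1
          (show k < k + 1 by omega) hk2
        have h5 := measureReal_add_le (μ := K.cantorMeasure)
          (a := K.left n w + (K.d (n + 1) k + 1) * K.s (n + 1) - lam)
          (b := K.left n w + (K.d (n + 1) k + 1) * K.s (n + 1))
          (c := K.left n w + K.d (n + 1) (k + 1) * K.s (n + 1))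
          (d := K.left n w + K.s n)
          (a' := K.right n w - y) (d' := K.right n w) (by nlinarith) (by linarith) (by linarith)
          (by nlinarith) (by linarith)
        have h6 := mul_le_mul_of_nonneg_left h4 hA
        have h7 := mul_le_mul_of_nonneg_left h5 hA
        rw [mul_add] at h7
        linarith

/-- The measure of a final segment of a basic interval. -/
theorem rpow_le_suffix {t A : ℝ} (ht0 : 0 < t) (ht1 : t ≤ 1) (hA : 0 ≤ A) {N : ℕ}
    (hβ : ∀ n, N ≤ n → ∀ k, 1 ≤ k → k < K.m (n + 1) →
      (K.s n - (K.d (n + 1) k + 1) * K.s (n + 1)) ^ t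
        ≤ A * ((K.m (n + 1) - k) / K.mu (n + 1)))
    {n : ℕ} (hn : N ≤ n) {w : ℕ → ℕ} (hw : K.IsWord w) {y : ℝ} (hy : 0 ≤ y) (hys : y ≤ K.s n) :
    y ^ t ≤ A * K.cantorMeasure.real (Icc (K.right n w - y) (K.right n w)) :=
  le_of_forall_le_add_rpow_s ht0 fun j => rpow_le_suffix_add ht0 ht1 hA hβ j n hn w hw y hy hys

/-! ### Mass of balls centred in the Cantor set -/

/-- Case of a ball strictly inside the order-`n` interval and containing the child around `x`. The
block of children it contains is bounded by γ; the constant there is `2 ^ t * A` because γ, unlike α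
and β, carries no factor `2 ^ t` in the theorem. -/
theorem two_mul_rpow_le_of_central {t A : ℝ} (ht0 : 0 < t) (ht1 : t ≤ 1) (hA : 0 ≤ A) {N : ℕ}
    (hα : ∀ n, N ≤ n → ∀ k, 1 ≤ k → k < K.m (n + 1) →
      (K.d (n + 1) (k + 1) * K.s (n + 1)) ^ t ≤ A * (k / K.mu (n + 1)))
    (hβ : ∀ n, N ≤ n → ∀ k, 1 ≤ k → k < K.m (n + 1) →
      (K.s n - (K.d (n + 1) k + 1) * K.s (n + 1)) ^ t
        ≤ A * ((K.m (n + 1) - k) / K.mu (n + 1)))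
    (hγ : ∀ n, N ≤ n → ∀ w x, K.Codes w x → ∀ j₁ j₂, 1 ≤ j₁ → j₁ + 1 < j₂ → j₂ ≤ K.m (n + 1) →
      K.left n w + (K.d (n + 1) j₁ + 1) * K.s (n + 1) < x →
      x < K.left n w + K.d (n + 1) j₂ * K.s (n + 1) →
      (2 * min (x - (K.left n w + (K.d (n + 1) j₁ + 1) * K.s (n + 1)))
        (K.left n w + K.d (n + 1) j₂ * K.s (n + 1) - x)) ^ t
        ≤ 2 ^ t * A * ((j₂ - j₁ - 1) / K.mu (n + 1)))
    {w : ℕ → ℕ} {x ρ : ℝ} (hx : K.Codes w x) (hρ : 0 < ρ) {n : ℕ} (hn : N ≤ n)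
    (hl : x - ρ ≤ K.left (n + 1) w) (hr : K.right (n + 1) w ≤ x + ρ)
    (hl' : K.left n w < x - ρ) (hr' : x + ρ < K.right n w) :
    (2 * ρ) ^ t ≤ 2 ^ t * A * K.cantorMeasure.real (Icc (x - ρ) (x + ρ)) := by
  have hn1 : 1 ≤ n + 1 := by omega
  have hs := K.s_pos (n + 1)
  have hd1 := K.d_first (n + 1) hn1
  have hsn := K.s_eq n
  have hrn : K.right n w = K.left n w + K.s n := rfl
  have hxn := hx.2 (n + 1)
  have hw := hx.1
  obtain ⟨hi1, him⟩ := hw (n + 1) hn1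
  rw [right] at hr hxn
  rw [left_succ] at hl hr hxn
  obtain ⟨hxl, hxr⟩ := hxn
  have hH : 0 ≤ 2 ^ t * A := mul_nonneg (by positivity) hA
  -- The children contained in the ball run from this `k` to the `j` found below; `a` and `b` will
  -- be the facing endpoints of the two children just outside.
  obtain ⟨k, hk1, hki, hkA, hkA'⟩ := exists_first_ge hi1
    (f := fun k => K.left n w + K.d (n + 1) k * K.s (n + 1)) hl
  have hk2 : 1 < k := by
    refine hk1.lt_of_ne ?_
    rintro rfl
    simp only [hd1, zero_mul, add_zero] at hkA
    linarith
  obtain ⟨j₁, rfl⟩ : ∃ j, k = j + 1 := ⟨k - 1, by omega⟩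
  have hA1 := hkA' hk2
  rw [Nat.add_sub_cancel] at hA1
  obtain ⟨j, hj1, hjm, hjB, hjB'⟩ := exists_last_le (m := K.m (n + 1)) (hi1.trans him)
    (f := fun k => K.left n w + (K.d (n + 1) k + 1) * K.s (n + 1)) (y := x + ρ) (by
      have := d_mono (K := K) hn1 le_rfl hi1 him
      nlinarith)
  have hjlt : j < K.m (n + 1) := by
    refine hjm.lt_of_ne fun h => ?_
    rw [h, ← hsn] at hjB
    linarith
  have hB1 := hjB' hjlt
  have hij : w (n + 1) ≤ j := by
    by_contra! hcon
    have := d_mono (K := K) hn1 (show 1 ≤ j + 1 by omega) hcon him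
    nlinarith
  have hblock := le_cantorMeasure hw hk1 (hki.trans hij) hjm
  have hcount : ((j : ℝ) - (j₁ + 1 : ℕ) + 1) = ((j + 1 : ℕ) : ℝ) - j₁ - 1 := by push_cast; ring
  rw [hcount] at hblock
  have hgap1 := d_add_one_lt (K := K) hn1 (show 1 ≤ j₁ by omega) (Nat.lt_succ_self j₁)
    (hki.trans him)
  have hgap1' := d_mono (K := K) hn1 hk1 hki him
  have hgap2 := d_add_one_lt (K := K) hn1 hj1 (Nat.lt_succ_self j) hjlt
  have hgap2' := d_mono (K := K) hn1 hi1 hij hjm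
  replace hgap1 := mul_lt_mul_of_pos_right hgap1 hs
  replace hgap1' := mul_le_mul_of_nonneg_right hgap1' hs.le
  replace hgap2 := mul_lt_mul_of_pos_right hgap2 hs
  replace hgap2' := mul_le_mul_of_nonneg_right hgap2' hs.le
  have hcent := hγ n hn w x hx j₁ (j + 1) (by omega) (by omega) hjlt (by linarith) (by linarith)
  set a := K.left n w + (K.d (n + 1) j₁ + 1) * K.s (n + 1) with ha
  set b := K.left n w + K.d (n + 1) (j + 1) * K.s (n + 1) with hb
  have hax : a < x := by linarith
  have hxb : x < b := by linarith
  have hmin : 0 < min (x - a) (b - x) := lt_min (by linarith) (by linarith)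
  have hcent' := hcent.trans (mul_le_mul_of_nonneg_left hblock hH)
  by_cases hle : ρ ≤ min (x - a) (b - x)
  · refine (Real.rpow_le_rpow (by linarith) (mul_le_mul_of_nonneg_left hle zero_le_two)
      ht0.le).trans (hcent'.trans (mul_le_mul_of_nonneg_left ?_ hH))
    exact measureReal_mono (Icc_subset_Icc hkA hjB)
  · have hsplit : ∀ lam : ℝ, 0 ≤ lam → ρ = min (x - a) (b - x) + lam →
        (2 * ρ) ^ t ≤ (2 * min (x - a) (b - x)) ^ t + 2 ^ t * lam ^ t := by
      intro lam hlam he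
      rw [← Real.mul_rpow zero_le_two hlam, he, mul_add]
      exact Real.rpow_add_le_add_rpow (by positivity) (by positivity) ht0.le ht1
    rcases le_total (x - a) (b - x) with hc | hc
    · rw [min_eq_left hc] at hsplit hcent' hle
      have hs1 := hsplit (a - (x - ρ)) (by linarith) (by ring)
      have hsuf := rpow_le_suffix ht0 ht1 hA hβ (n := n + 1) (by omega)
        (hw.update (n := n + 1) (k := j₁) (by omega) (by omega)) (y := a - (x - ρ))
        (by linarith) (by linarith)
      rw [right_update, ← ha, sub_sub_cancel] at hsuf
      have hadd := measureReal_add_le (μ := K.cantorMeasure) (a := x - ρ) (b := a)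
        (c := K.left n w + K.d (n + 1) (j₁ + 1) * K.s (n + 1))
        (d := K.left n w + (K.d (n + 1) j + 1) * K.s (n + 1)) (a' := x - ρ) (d' := x + ρ)
        (by linarith) le_rfl (by linarith) hkA hjB
      have h1 := mul_le_mul_of_nonneg_left hsuf (show (0 : ℝ) ≤ 2 ^ t by positivity)
      have h2 := mul_le_mul_of_nonneg_left hadd hH
      rw [← mul_assoc] at h1
      rw [mul_add] at h2
      linarith
    · rw [min_eq_right hc] at hsplit hcent' hle
      have hs1 := hsplit (x + ρ - b) (by linarith) (by ring)
      have hpre := rpow_le_prefix ht0 ht1 hA hα (n := n + 1) (by omega)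
        (hw.update (n := n + 1) (k := j + 1) (by omega) hjlt) (y := x + ρ - b)
        (by linarith) (by linarith)
      rw [left_update, ← hb, add_sub_cancel] at hpre
      have hadd := measureReal_add_le (μ := K.cantorMeasure)
        (a := K.left n w + K.d (n + 1) (j₁ + 1) * K.s (n + 1))
        (b := K.left n w + (K.d (n + 1) j + 1) * K.s (n + 1)) (c := b) (d := x + ρ)
        (a' := x - ρ) (d' := x + ρ)
        (by linarith) hkA hjB (by linarith) le_rfl
      have h1 := mul_le_mul_of_nonneg_left hpre (show (0 : ℝ) ≤ 2 ^ t by positivity)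
      have h2 := mul_le_mul_of_nonneg_left hadd hH
      rw [← mul_assoc] at h1
      rw [mul_add] at h2
      linarith

theorem two_mul_rpow_le {t A : ℝ} (ht0 : 0 < t) (ht1 : t ≤ 1) (hA : 0 ≤ A) {N : ℕ}
    (hα : ∀ n, N ≤ n → ∀ k, 1 ≤ k → k < K.m (n + 1) →
      (K.d (n + 1) (k + 1) * K.s (n + 1)) ^ t ≤ A * (k / K.mu (n + 1)))
    (hβ : ∀ n, N ≤ n → ∀ k, 1 ≤ k → k < K.m (n + 1) →
      (K.s n - (K.d (n + 1) k + 1) * K.s (n + 1)) ^ t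
        ≤ A * ((K.m (n + 1) - k) / K.mu (n + 1)))
    (hγ : ∀ n, N ≤ n → ∀ w x, K.Codes w x → ∀ j₁ j₂, 1 ≤ j₁ → j₁ + 1 < j₂ → j₂ ≤ K.m (n + 1) →
      K.left n w + (K.d (n + 1) j₁ + 1) * K.s (n + 1) < x →
      x < K.left n w + K.d (n + 1) j₂ * K.s (n + 1) →
      (2 * min (x - (K.left n w + (K.d (n + 1) j₁ + 1) * K.s (n + 1)))
        (K.left n w + K.d (n + 1) j₂ * K.s (n + 1) - x)) ^ t
        ≤ 2 ^ t * A * ((j₂ - j₁ - 1) / K.mu (n + 1)))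
    {x ρ : ℝ} (hx : x ∈ K.cantorSet) (hρ : 0 < ρ) (hρN : 2 * ρ < K.s N) :
    (2 * ρ) ^ t ≤ 2 ^ t * A * K.cantorMeasure.real (Icc (x - ρ) (x + ρ)) := by
  obtain ⟨w, hw⟩ := exists_codes hx
  have hex : ∃ n, x - ρ ≤ K.left n w ∧ K.right n w ≤ x + ρ := by
    obtain ⟨n, hn⟩ := (K.tendsto_s.eventually_lt_const hρ).exists
    have h := hw.2 n
    rw [right] at h
    exact ⟨n, by linarith [h.2], by rw [right]; linarith [h.1]⟩
  classical
  -- The least order whose interval around `x` fits in the ball; one order up, the ball misses at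
  -- least one end.
  have hspec := Nat.find_spec hex
  have hNn : N < Nat.find hex := by
    by_contra! hcon
    have h1 := K.s_antitone hcon
    rw [right] at hspec
    linarith [hspec.1, hspec.2]
  obtain ⟨n, hn⟩ : ∃ n, Nat.find hex = n + 1 := ⟨Nat.find hex - 1, by omega⟩
  have hmin := Nat.find_min hex (show n < Nat.find hex by omega)
  rw [hn] at hspec hNn
  have hxn := hw.2 n
  have hrn : K.right n w = K.left n w + K.s n := rfl
  have h2t : (0 : ℝ) ≤ 2 ^ t := by positivity
  -- An end segment of length at least `ρ` inside the ball suffices, as `(2 * ρ) ^ t = 2 ^ t * ρ ^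
  -- t`.
  have hfin : ∀ y : ℝ, ρ ≤ y → ∀ S, S ⊆ Icc (x - ρ) (x + ρ) →
      y ^ t ≤ A * K.cantorMeasure.real S →
      (2 * ρ) ^ t ≤ 2 ^ t * A * K.cantorMeasure.real (Icc (x - ρ) (x + ρ)) := by
    intro y hy S hS h
    rw [Real.mul_rpow zero_le_two hρ.le, mul_assoc]
    refine mul_le_mul_of_nonneg_left ((Real.rpow_le_rpow hρ.le hy ht0.le).trans (h.trans ?_)) h2t
    exact mul_le_mul_of_nonneg_left (measureReal_mono hS) hA
  by_cases hl : x - ρ ≤ K.left n w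
  · have hr : x + ρ < K.right n w := by
      by_contra! hcon
      exact hmin ⟨hl, hcon⟩
    refine hfin (x + ρ - K.left n w) (by linarith [hxn.1]) _ ?_
      (rpow_le_prefix ht0 ht1 hA hα (show N ≤ n by omega) hw.1 (by linarith [hxn.1])
        (by linarith))
    exact Icc_subset_Icc hl (by linarith)
  · push Not at hl
    by_cases hr : K.right n w ≤ x + ρ
    · refine hfin (K.right n w - (x - ρ)) (by linarith [hxn.2]) _ ?_
        (rpow_le_suffix ht0 ht1 hA hβ (show N ≤ n by omega) hw.1 (by linarith [hxn.2])
          (by linarith))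
      exact Icc_subset_Icc (by linarith) hr
    · push Not at hr
      exact two_mul_rpow_le_of_central ht0 ht1 hA hα hβ hγ hw hρ (by omega) hspec.1 hspec.2 hl hr

end CantorData

/-! ### From ball estimates to packing measure -/

open MeasureTheory in
/-- A set has small packing measure if a probability measure is large on small balls. -/
theorem packingMeasure_le {ν : Measure ℝ} [IsProbabilityMeasure ν] {t H δ : ℝ} {A : Set ℝ}
    (hδ : 0 < δ) (hH : 0 ≤ H)
    (h : ∀ x ∈ A, ∀ ρ, 0 < ρ → 2 * ρ ≤ δ →
      (2 * ρ) ^ t ≤ H * ν.real (Metric.closedBall x ρ)) :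
    packingMeasure t A ≤ ENNReal.ofReal H := by
  have h1 : packingPremeasure t A ≤ ENNReal.ofReal H := by
    refine (iInf₂_le δ hδ).trans (iSup₂_le fun F hF => ?_)
    rw [← ENNReal.ofReal_sum_of_nonneg fun p hp =>
      Real.rpow_nonneg (by linarith [(hF.1 p hp).2.1]) _]
    refine ENNReal.ofReal_le_ofReal ?_
    calc ∑ p ∈ F, (2 * p.2) ^ t ≤ ∑ p ∈ F, H * ν.real (Metric.closedBall p.1 p.2) :=
          Finset.sum_le_sum fun p hp => h _ (hF.1 p hp).1 _ (hF.1 p hp).2.1 (hF.1 p hp).2.2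
      _ = H * ν.real (⋃ p ∈ F, Metric.closedBall p.1 p.2) := by
          rw [← Finset.mul_sum, measureReal_biUnion_finset hF.2
            fun _ _ => Metric.isClosed_closedBall.measurableSet]
      _ ≤ H := mul_le_of_le_one_right hH measureReal_le_one
  have h0 : packingPremeasure t (∅ : Set ℝ) = 0 := by
    refine le_antisymm ((iInf₂_le δ hδ).trans (iSup₂_le fun F hF => ?_)) zero_le
    rw [Finset.sum_eq_zero fun p hp => ((hF.1 p hp).1).elim]
  refine (iInf₂_le (fun i => if i = 0 then A else ∅) fun x hx =>
    mem_iUnion.2 ⟨0, by simpa using hx⟩).trans ?_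
  rw [tsum_eq_single 0 fun i hi => by simp [hi, h0]]
  simpa using h1

-- Besicovitch's theorem extracts disjoint good balls covering ν-almost all of `G`; finite
-- subfamilies are packings whose sums approach at least `h` times ν of `G`. No measurability of `G`
-- is needed.
open MeasureTheory in
theorem le_packingPremeasure {ν : Measure ℝ} [IsFiniteMeasure ν] {t h : ℝ} {E : Set ℝ}
    {G : Set ℝ} (hGE : G ⊆ E)
    (hball : ∀ x ∈ G, ∀ δ > 0, ∃ ρ, 0 < ρ ∧ ρ < δ ∧
      h * ν.real (Metric.closedBall x ρ) ≤ (2 * ρ) ^ t) :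
    ENNReal.ofReal h * ν G ≤ packingPremeasure t E := by
  refine le_iInf₂ fun δ hδ => ?_
  obtain ⟨T, r, hT, hTG, hr, hν, hdisj⟩ := Besicovitch.exists_disjoint_closedBall_covering_ae ν
    (fun x => {ρ | h * ν.real (Metric.closedBall x ρ) ≤ (2 * ρ) ^ t}) G
    (fun x hx ε hε => by
      obtain ⟨ρ, h1, h2, h3⟩ := hball x hx ε hε
      exact ⟨ρ, h3, h1, h2⟩) (fun _ => δ / 2) (fun _ _ => half_pos hδ)
  have hle : ν G ≤ ∑' x : T, ν (Metric.closedBall (x : ℝ) (r x)) := by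
    calc ν G ≤ ν (G \ ⋃ x ∈ T, Metric.closedBall x (r x))
          + ν (⋃ x ∈ T, Metric.closedBall x (r x)) :=
          (measure_mono (by rw [sdiff_union_self]; exact subset_union_left)).trans
            (measure_union_le _ _)
      _ ≤ _ := by rw [hν, zero_add]; exact measure_biUnion_le ν hT _
  refine (mul_le_mul_right hle _).trans ?_
  rw [← ENNReal.tsum_mul_left, ENNReal.tsum_eq_iSup_sum]
  refine iSup_le fun u => ?_
  let e : T ↪ ℝ × ℝ := ⟨fun x => (x, r x), fun x y hxy => Subtype.ext (congrArg Prod.fst hxy)⟩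
  have hpack : IsPacking δ E (u.map e) := by
    constructor
    · intro p hp
      obtain ⟨x, _, rfl⟩ := Finset.mem_map.1 hp
      have h1 := (hr x x.2).2
      exact ⟨hGE (hTG x.2), h1.1, by
        have := h1.2; change 2 * r x ≤ δ; linarith⟩
    · intro p hp q hq hpq
      obtain ⟨x, _, rfl⟩ := Finset.mem_map.1 (Finset.mem_coe.1 hp)
      obtain ⟨y, _, rfl⟩ := Finset.mem_map.1 (Finset.mem_coe.1 hq)
      exact hdisj x.2 y.2 fun hxy => hpq (congrArg e (Subtype.ext hxy))
  refine le_trans ?_ (le_iSup₂ (f := fun F (_ : IsPacking δ E F) =>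
    ∑ p ∈ F, ENNReal.ofReal ((2 * p.2) ^ t)) (u.map e) hpack)
  rw [Finset.sum_map]
  refine Finset.sum_le_sum fun x _ => ?_
  have h1 := (hr x x.2).1
  rw [← ofReal_measureReal, ← ENNReal.ofReal_mul' measureReal_nonneg]
  exact ENNReal.ofReal_le_ofReal h1

open MeasureTheory in
/-- A set has large packing measure if it supports a measure that is small on many small balls. -/
theorem le_packingMeasure {ν : Measure ℝ} [IsFiniteMeasure ν] {t h : ℝ} {A G : Set ℝ}
    (hGA : G ⊆ A) (hG : 1 ≤ ν G)
    (hball : ∀ x ∈ G, ∀ δ > 0, ∃ ρ, 0 < ρ ∧ ρ < δ ∧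
      h * ν.real (Metric.closedBall x ρ) ≤ (2 * ρ) ^ t) :
    ENNReal.ofReal h ≤ packingMeasure t A := by
  refine le_iInf₂ fun S hS => ?_
  calc ENNReal.ofReal h ≤ ENNReal.ofReal h * ν G := le_mul_of_one_le_right zero_le hG
    _ ≤ ENNReal.ofReal h * ∑' i, ν (S i ∩ G) := by
        refine mul_le_mul_right ((measure_mono ?_).trans (measure_iUnion_le _)) _
        rw [← iUnion_inter]
        exact subset_inter (hGA.trans hS) subset_rfl
    _ = ∑' i, ENNReal.ofReal h * ν (S i ∩ G) := ENNReal.tsum_mul_left.symm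
    _ ≤ _ := ENNReal.tsum_le_tsum fun i =>
        le_packingPremeasure inter_subset_left fun x hx => hball x hx.2

/-! ### Prescribed blocks in almost every word -/

namespace CantorData
open MeasureTheory ProbabilityTheory

variable {K : CantorData}

/-- Almost every word contains infinitely many of the blocks prescribed by `v`. -/
theorem ae_frequently_block {M : ℕ} (hM : ∀ n, 1 ≤ n → K.m n ≤ M) (L : ℕ) {S : Set ℕ}
    (hS : ∃ᶠ n in atTop, n ∈ S) {v : ℕ → ℕ → ℕ} (hv : ∀ n, K.IsWord (v n)) :
    ∀ᵐ w ∂K.wordMeasure, ∃ᶠ n in atTop, n ∈ S ∧ ∀ i ∈ Finset.Icc (n + 1) (n + L), w i = v n i := by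
  obtain ⟨φ, hφ, hφS⟩ := extraction_of_frequently_atTop hS
  -- Spacing the positions by more than `L` makes the blocks disjoint, hence the events independent.
  let q : ℕ → ℕ := fun j => φ ((L + 1) * j)
  have hq : ∀ i j, i < j → q i + L < q j := by
    intro i j hij
    have h1 : φ ((L + 1) * i) + (L + 1) ≤ φ ((L + 1) * i + (L + 1)) :=
      (add_comm _ _).trans_le ((hφ.add_le_nat (L + 1) _).trans_eq (congrArg φ (add_comm _ _)))
    have h2 : φ ((L + 1) * i + (L + 1)) ≤ φ ((L + 1) * j) :=
      hφ.monotone (by rw [← Nat.mul_succ]; exact Nat.mul_le_mul_left _ hij)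
    simp only [q]
    omega
  let I : ℕ → Finset ℕ := fun j => Finset.Icc (q j + 1) (q j + L)
  have hI : ∀ i a b, i ∈ I a → i ∈ I b → a = b := by
    intro i a b ha hb
    simp only [I, Finset.mem_Icc] at ha hb
    rcases lt_trichotomy a b with h | h | h
    · have := hq a b h; omega
    · exact h
    · have := hq b a h; omega
  let E : ℕ → Set (ℕ → ℕ) := fun j => {w | ∀ i ∈ I j, w i = v (q j) i}
  have hEpi : ∀ j, E j = Set.pi (I j) fun i => {v (q j) i} := by
    intro j; ext w; simp [E, Set.mem_pi]
  have hEm : ∀ j, MeasurableSet (E j) := fun j => by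
    rw [hEpi]
    exact MeasurableSet.pi (I j).countable_toSet fun _ _ => measurableSet_singleton _
  have hP : ∀ j, K.wordMeasure (E j) = ∏ i ∈ I j, K.letterMeasure i {v (q j) i} := by
    intro j
    rw [hEpi, wordMeasure]
    exact Measure.infinitePi_pi _ fun _ _ => measurableSet_singleton _
  have hind : iIndepSet E K.wordMeasure := by
    rw [iIndepSet_iff_meas_biInter hEm]
    intro s
    let T : ℕ → Set ℕ := fun i => {x | ∀ j ∈ s, i ∈ I j → x = v (q j) i}
    have hT : ∀ j ∈ s, ∀ i ∈ I j, T i = {v (q j) i} := by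
      intro j hj i hi
      ext x
      simp only [T, mem_ofPred_eq, mem_singleton_iff]
      refine ⟨fun h => h j hj hi, fun h j' _ hi' => ?_⟩
      rw [hI i j' j hi' hi]; exact h
    have h1 : (⋂ j ∈ s, E j) = Set.pi (s.biUnion I : Finset ℕ) T := by
      ext w
      simp only [E, T, mem_iInter, mem_ofPred_eq, Set.mem_pi, Finset.coe_biUnion, mem_iUnion,
        Finset.mem_coe]
      exact ⟨fun h i _ j hj hi => h j hj i hi, fun h j hj i hi => h i ⟨j, hj, hi⟩ j hj hi⟩
    rw [h1, wordMeasure, Measure.infinitePi_pi _ fun _ _ => MeasurableSet.of_discrete,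
      Finset.prod_biUnion]
    · refine Finset.prod_congr rfl fun j hj => ?_
      rw [← wordMeasure, hP]
      exact Finset.prod_congr rfl fun i hi => by rw [hT j hj i hi]
    · intro a _ b _ hab
      exact Finset.disjoint_left.2 fun i ha hb => hab (hI i a b ha hb)
  have hM0 : 0 < M := by have := K.two_le_m 1 le_rfl; have := hM 1 le_rfl; omega
  -- Each prescribed letter has probability at least `1 / M`, so the probabilities have infinite
  -- sum.
  have hlow : ∀ j, ((M : ℝ≥0∞)⁻¹) ^ L ≤ K.wordMeasure (E j) := by
    intro j
    rw [hP]
    have hcard : (I j).card = L := by simp [I]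
    rw [← hcard, ← Finset.prod_const]
    refine Finset.prod_le_prod' fun i hi => ?_
    have hi1 : 1 ≤ i := by have := (Finset.mem_Icc.1 hi).1; omega
    have h2 := letterMeasure_apply (K := K) hi1 (B := {v (q j) i})
      (by simpa using hv (q j) i hi1)
    rw [Finset.coe_singleton] at h2
    rw [h2]
    simpa using hM i hi1
  have hsum : (∑' j, K.wordMeasure (E j)) = ∞ := by
    refine top_unique (le_trans ?_ (ENNReal.tsum_le_tsum hlow))
    rw [ENNReal.tsum_const_eq_top_of_ne_zero]
    exact pow_ne_zero _ (ENNReal.inv_ne_zero.2 (ENNReal.natCast_ne_top _))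
  have hlim := measure_limsup_eq_one hEm hind hsum
  have hae := (mem_ae_iff_prob_eq_one (MeasurableSet.measurableSet_limsup hEm)).2 hlim
  filter_upwards [hae] with w hw
  rw [mem_limsup_iff_frequently_mem] at hw
  rw [frequently_atTop] at hw ⊢
  intro a
  obtain ⟨j, hj, hwj⟩ := hw a
  refine ⟨q j, ?_, hφS _, hwj⟩
  calc a ≤ (L + 1) * j := hj.trans (Nat.le_mul_of_pos_left _ (by omega))
    _ ≤ q j := hφ.le_apply

/-- Reduces the lower bound to one order `p` at a time: a block of fixed length `L` after order `p`
must force a good ball, whatever the other letters are. -/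
theorem ofReal_le_packingMeasure {M : ℕ} (hM : ∀ n, 1 ≤ n → K.m n ≤ M) (L : ℕ) {t h : ℝ}
    (hfreq : ∃ᶠ p in atTop, ∃ v, K.IsWord v ∧ ∀ w, K.IsWord w →
      (∀ i ∈ Finset.Icc (p + 1) (p + L), w i = v i) →
      ∃ ρ, 0 < ρ ∧ ρ ≤ K.s p ∧
        h * K.cantorMeasure.real (Metric.closedBall (K.point w) ρ) ≤ (2 * ρ) ^ t) :
    ENNReal.ofReal h ≤ packingMeasure t K.cantorSet := by
  classical
  let S : Set ℕ := {p | ∃ v, K.IsWord v ∧ ∀ w, K.IsWord w →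
      (∀ i ∈ Finset.Icc (p + 1) (p + L), w i = v i) →
      ∃ ρ, 0 < ρ ∧ ρ ≤ K.s p ∧
        h * K.cantorMeasure.real (Metric.closedBall (K.point w) ρ) ≤ (2 * ρ) ^ t}
  have hv : ∀ p, ∃ v, K.IsWord v ∧ (p ∈ S → ∀ w, K.IsWord w →
      (∀ i ∈ Finset.Icc (p + 1) (p + L), w i = v i) →
      ∃ ρ, 0 < ρ ∧ ρ ≤ K.s p ∧
        h * K.cantorMeasure.real (Metric.closedBall (K.point w) ρ) ≤ (2 * ρ) ^ t) := by
    intro p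
    by_cases hp : p ∈ S
    · obtain ⟨v, h1, h2⟩ := hp
      exact ⟨v, h1, fun _ => h2⟩
    · exact ⟨_, isWord_one, fun h => absurd h hp⟩
  choose v hvw hvS using hv
  have hae := ae_frequently_block hM L (S := S) hfreq hvw
  let W : Set (ℕ → ℕ) := {w | K.IsWord w ∧
    ∃ᶠ n in atTop, n ∈ S ∧ ∀ i ∈ Finset.Icc (n + 1) (n + L), w i = v n i}
  have hW : K.wordMeasure W = 1 := by
    have h1 : W =ᵐ[K.wordMeasure] univ := by
      rw [eventuallyEq_univ]
      filter_upwards [hae, ae_isWord] with w h1 h2 using ⟨h2, h1⟩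
    rw [measure_congr h1, measure_univ]
  refine le_packingMeasure (ν := K.cantorMeasure) (G := K.point '' W) ?_ ?_ ?_
  · rintro _ ⟨w, hw, rfl⟩
    exact hw.1.codes_point.mem_cantorSet
  · rw [← hW]
    -- The image of `W` need not be measurable, so only this outer-measure inequality is used.
    exact Measure.le_map_apply_image measurable_point.aemeasurable W
  · rintro _ ⟨w, hw, rfl⟩ δ hδ
    obtain ⟨p, ⟨hpS, hpw⟩, hps⟩ :=
      (hw.2.and_eventually (K.tendsto_s.eventually_lt_const hδ)).exists
    obtain ⟨ρ, h1, h2, h3⟩ := hvS p hpS w hw.1 hpw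
    exact ⟨ρ, h1, h2.trans_lt hps, h3⟩

/-! ### Blocks that force balls of small mass -/

theorem exists_shrink {h h' : ℝ} (h0 : 0 ≤ h) (hh : h < h') :
    ∃ η, 0 < η ∧ η < 1 ∧ h ≤ (1 - η) * h' := by
  have h1 : 0 < h' := by linarith
  refine ⟨(h' - h) / (2 * h'), div_pos (by linarith) (by linarith), ?_, ?_⟩
  · rw [div_lt_one (by linarith)]; linarith
  · have : (1 - (h' - h) / (2 * h')) * h' = (h' + h) / 2 := by field_simp; ring
    linarith

/-- The slack between `h` and `h'` pays for shrinking the radius by `1 - η`, since `1 - η ≤ (1 - η)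
^ t` for `t ≤ 1`. -/
theorem mul_le_shrink_rpow {t h h' η ρ q x : ℝ} (ht1 : t ≤ 1) (hη0 : 0 < η)
    (hη1 : η < 1) (h0 : 0 ≤ h) (hρ : 0 ≤ ρ) (hh : h ≤ (1 - η) * h') (hq : h' * q ≤ (2 * ρ) ^ t)
    (hxq : x ≤ q) (hq0 : 0 ≤ q) : h * x ≤ (2 * ((1 - η) * ρ)) ^ t := by
  have h1 : (1 - η) ≤ (1 - η) ^ t := by
    simpa using Real.rpow_le_rpow_of_exponent_ge (x := 1 - η) (by linarith) (by linarith) ht1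
  calc h * x ≤ (1 - η) * h' * q :=
        (mul_le_mul_of_nonneg_left hxq h0).trans (mul_le_mul_of_nonneg_right hh hq0)
    _ = (1 - η) * (h' * q) := by ring
    _ ≤ (1 - η) * (2 * ρ) ^ t := mul_le_mul_of_nonneg_left hq (by linarith)
    _ ≤ (1 - η) ^ t * (2 * ρ) ^ t := mul_le_mul_of_nonneg_right h1 (by positivity)
    _ = _ := by
        rw [← Real.mul_rpow (by linarith) (by linarith)]; congr 1; ring

theorem frequently_add {Q : ℕ → Prop} (h : ∃ᶠ n in atTop, Q n) (l : ℕ) :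
    ∃ᶠ p in atTop, Q (p + l) := by
  rw [frequently_atTop] at h ⊢
  intro a
  obtain ⟨n, hn, hQ⟩ := h (a + l)
  exact ⟨n - l, by omega, by rwa [Nat.sub_add_cancel (by omega)]⟩

theorem exists_two_pow {a b : ℝ} (ha : 0 < a) (hb : 0 < b) :
    ∃ l : ℕ, 1 < a * 2 ^ l ∧ 1 < b * 2 ^ l := by
  obtain ⟨l, hl⟩ := pow_unbounded_of_one_lt (max (1 / a) (1 / b)) (one_lt_two)
  refine ⟨l, ?_, ?_⟩
  · have := (le_max_left _ _).trans_lt hl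
    rw [div_lt_iff₀ ha] at this; linarith
  · have := (le_max_right _ _).trans_lt hl
    rw [div_lt_iff₀ hb] at this; linarith

theorem s_add_lt {a : ℝ} {l : ℕ} (h : 1 < a * 2 ^ l) (n : ℕ) : K.s (n + l) < a * K.s n := by
  refine (K.s_add_le n l).trans_lt ?_
  rw [div_lt_iff₀ (by positivity)]
  nlinarith [K.s_pos n]

theorem left_add_eq {w : ℕ → ℕ} {n j : ℕ} (h : ∀ i ∈ Finset.Icc (n + 1) (n + j), w i = 1) :
    K.left (n + j) w = K.left n w := by
  induction j with
  | zero => rfl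
  | succ j ih =>
    rw [← add_assoc, left_succ, ih fun i hi => h i (by simp only [Finset.mem_Icc] at hi ⊢; omega),
      h (n + j + 1) (by simp only [Finset.mem_Icc]; omega), K.d_first _ (by omega)]
    ring

theorem right_add_eq {w : ℕ → ℕ} {n j : ℕ} (h : ∀ i ∈ Finset.Icc (n + 1) (n + j), w i = K.m i) :
    K.right (n + j) w = K.right n w := by
  induction j with
  | zero => rfl
  | succ j ih =>
    rw [← ih fun i hi => h i (by simp only [Finset.mem_Icc] at hi ⊢; omega), ← add_assoc, right,
      right, left_succ, h (n + j + 1) (by simp only [Finset.mem_Icc]; omega), K.s_eq (n + j)]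
    ring

/-- The block is `2 * l + 1` ones. The first `l` put the order `p + l` interval at the left end of
the order `p` one, where the gap on its left exceeds the radius; the others put the point so near
that left end that the shrunken ball meets only the first `k` children. -/
theorem ofReal_le_packingMeasure_of_left {M : ℕ} (hM : ∀ n, 1 ≤ n → K.m n ≤ M) {c : ℝ}
    (hc : 1 < c) (hsep : ∀ n, 1 ≤ n → ∀ j, 1 ≤ j → j < K.m n → c ≤ K.d n (j + 1) - K.d n j)
    {t h h' : ℝ} (ht1 : t ≤ 1) (h0 : 0 ≤ h) (hh : h < h')
    (hfreq : ∃ᶠ n in atTop, ∃ k, 1 ≤ k ∧ k < K.m (n + 1) ∧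
      h' * (k / K.mu (n + 1)) ≤ (2 * (K.d (n + 1) (k + 1) * K.s (n + 1))) ^ t) :
    ENNReal.ofReal h ≤ packingMeasure t K.cantorSet := by
  obtain ⟨η, hη0, hη1, hη⟩ := exists_shrink h0 hh
  obtain ⟨l, hl1, hl2⟩ := exists_two_pow hη0 (show 0 < c - 1 by linarith)
  refine ofReal_le_packingMeasure hM (2 * l + 1) ((frequently_add hfreq l).mono ?_)
  rintro p ⟨k, hk1, hkm, hk⟩
  refine ⟨_, isWord_one, fun w hw hblock => ?_⟩
  have hs := K.s_pos (p + l + 1)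
  have hsn := K.s_eq (p + l)
  have hρ0 : K.s (p + l + 1) ≤ K.d (p + l + 1) (k + 1) * K.s (p + l + 1) := by
    have := d_add_one_lt (K := K) (n := p + l + 1) (by omega) le_rfl (show 1 < k + 1 by omega) hkm
    rw [K.d_first _ (by omega)] at this
    nlinarith
  have hρs : K.d (p + l + 1) (k + 1) * K.s (p + l + 1) ≤ K.s (p + l) := by
    have := d_mono (K := K) (n := p + l + 1) (by omega) (show 1 ≤ k + 1 by omega) hkm le_rfl
    nlinarith
  set ρ := K.d (p + l + 1) (k + 1) * K.s (p + l + 1) with hρ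
  have hρlt : (1 - η) * ρ < ρ := by nlinarith
  have hleft1 : K.left (p + l) w = K.left p w := left_add_eq fun i hi => hblock i (by
    simp only [Finset.mem_Icc] at hi ⊢; omega)
  have hleft2 : K.left (p + l + 1 + l) w = K.left (p + l) w := by
    rw [add_assoc (p + l)]
    exact left_add_eq fun i hi => hblock i (by simp only [Finset.mem_Icc] at hi ⊢; omega)
  have hx := hw.codes_point.2 (p + l + 1 + l)
  rw [right, hleft2] at hx
  have hsl := s_add_lt (K := K) hl1 (p + l + 1)
  have hxρ : K.point w + (1 - η) * ρ < K.left (p + l) w + ρ := by nlinarith [hx.2]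
  refine ⟨(1 - η) * ρ, mul_pos (by linarith) (by linarith),
    hρlt.le.trans (hρs.trans (K.s_antitone (by omega))), ?_⟩
  refine mul_le_shrink_rpow ht1 hη0 hη1 h0 (by linarith) hη hk ?_ (by positivity)
  have hcount : (k : ℝ) / K.mu (p + l + 1) = ((k : ℝ) - (1 : ℕ) + 1) / K.mu (p + l + 1) := by
    congr 1; push_cast; ring
  rw [hcount]
  refine cantorMeasure_le hw le_rfl hk1 hkm.le Metric.isClosed_closedBall.measurableSet ?_
  intro w' hw' hball
  rw [Real.closedBall_eq_Icc] at hball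
  have hx' := hw'.codes_point.2
  have hag : Agree (p + l) w w' := by
    by_contra hcon
    obtain ⟨i, hi, hag, hne⟩ := exists_first_difference hcon
    rcases hne.lt_or_gt with hlt | hlt
    · have h1 := right_lt_left hw hw' hag hlt
      have h2 := hw.right_antitone (show i + 1 ≤ p + l by omega)
      have h3 := (hx' (i + 1)).1
      simp only [right] at h1 h2
      linarith [hball.2]
    · have hip : i + 1 ≤ p := by
        by_contra! hcon
        have := hblock (i + 1) (by simp only [Finset.mem_Icc]; omega)
        have := (hw' (i + 1) (by omega)).1
        omega
      have h1 := right_add_le_left (by linarith) hsep hw' hw hag.symm hlt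
      have h2 := hw.left_mono hip
      have h3 := (hx' (i + 1)).2
      have h4 := s_add_lt (K := K) hl2 p
      have h5 := mul_le_mul_of_nonneg_left (K.s_antitone hip) (show 0 ≤ c - 1 by linarith)
      simp only at h2
      linarith [hball.1, hx.1]
  refine ⟨hag, (hw' _ (by omega)).1, ?_⟩
  by_contra! hcon
  have h1 := (hx' (p + l + 1)).1
  rw [left_succ, ← hag.left_eq] at h1
  have h2 := mul_le_mul_of_nonneg_right (d_mono (K := K) (n := p + l + 1) (by omega)
    (show 1 ≤ k + 1 by omega) hcon (hw' _ (by omega)).2) hs.le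
  linarith [hball.2]

/-- Mirror image of `ofReal_le_packingMeasure_of_left`, with the largest letters in place of ones.
-/
theorem ofReal_le_packingMeasure_of_right {M : ℕ} (hM : ∀ n, 1 ≤ n → K.m n ≤ M) {c : ℝ}
    (hc : 1 < c) (hsep : ∀ n, 1 ≤ n → ∀ j, 1 ≤ j → j < K.m n → c ≤ K.d n (j + 1) - K.d n j)
    {t h h' : ℝ} (ht1 : t ≤ 1) (h0 : 0 ≤ h) (hh : h < h')
    (hfreq : ∃ᶠ n in atTop, ∃ k, 1 ≤ k ∧ k < K.m (n + 1) ∧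
      h' * ((K.m (n + 1) - k) / K.mu (n + 1))
        ≤ (2 * (K.s n - (K.d (n + 1) k + 1) * K.s (n + 1))) ^ t) :
    ENNReal.ofReal h ≤ packingMeasure t K.cantorSet := by
  obtain ⟨η, hη0, hη1, hη⟩ := exists_shrink h0 hh
  obtain ⟨l, hl1, hl2⟩ := exists_two_pow hη0 (show 0 < c - 1 by linarith)
  refine ofReal_le_packingMeasure hM (2 * l + 1) ((frequently_add hfreq l).mono ?_)
  rintro p ⟨k, hk1, hkm, hk⟩
  refine ⟨_, isWord_m, fun w hw hblock => ?_⟩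
  have hs := K.s_pos (p + l + 1)
  have hsn := K.s_eq (p + l)
  have hρ0 : K.s (p + l + 1) ≤ K.s (p + l) - (K.d (p + l + 1) k + 1) * K.s (p + l + 1) := by
    have := d_add_one_lt (K := K) (n := p + l + 1) (by omega) hk1 hkm le_rfl
    nlinarith
  have hρs : K.s (p + l) - (K.d (p + l + 1) k + 1) * K.s (p + l + 1) ≤ K.s (p + l) := by
    have := d_nonneg (K := K) (n := p + l + 1) (by omega) hk1 hkm.le
    nlinarith
  set ρ := K.s (p + l) - (K.d (p + l + 1) k + 1) * K.s (p + l + 1) with hρ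
  have hρlt : (1 - η) * ρ < ρ := by nlinarith
  have hright1 : K.right (p + l) w = K.right p w := right_add_eq fun i hi => hblock i (by
    simp only [Finset.mem_Icc] at hi ⊢; omega)
  have hright2 : K.right (p + l + 1 + l) w = K.right (p + l) w := by
    rw [add_assoc (p + l)]
    exact right_add_eq fun i hi => hblock i (by simp only [Finset.mem_Icc] at hi ⊢; omega)
  have hx := hw.codes_point.2 (p + l + 1 + l)
  rw [hright2] at hx
  have hxl : K.right (p + l) w - K.s (p + l + 1 + l) ≤ K.point w := by
    rw [← hright2, right]; linarith [hx.1]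
  have hsl := s_add_lt (K := K) hl1 (p + l + 1)
  have hxρ : K.right (p + l) w - ρ < K.point w - (1 - η) * ρ := by nlinarith
  refine ⟨(1 - η) * ρ, mul_pos (by linarith) (by linarith),
    hρlt.le.trans (hρs.trans (K.s_antitone (by omega))), ?_⟩
  refine mul_le_shrink_rpow ht1 hη0 hη1 h0 (by linarith) hη hk ?_
    (div_nonneg (sub_nonneg.2 (by exact_mod_cast hkm.le)) (by positivity))
  have hcount : ((K.m (p + l + 1) : ℝ) - k) / K.mu (p + l + 1)
      = ((K.m (p + l + 1) : ℝ) - (k + 1 : ℕ) + 1) / K.mu (p + l + 1) := by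
    congr 1; push_cast; ring
  rw [hcount]
  refine cantorMeasure_le hw (by omega) hkm le_rfl Metric.isClosed_closedBall.measurableSet ?_
  intro w' hw' hball
  rw [Real.closedBall_eq_Icc] at hball
  have hx' := hw'.codes_point.2
  have hag : Agree (p + l) w w' := by
    by_contra hcon
    obtain ⟨i, hi, hag, hne⟩ := exists_first_difference hcon
    rcases hne.symm.lt_or_gt with hlt | hlt
    · have h1 := right_lt_left hw' hw hag.symm hlt
      have h2 := hw.left_mono (show i + 1 ≤ p + l by omega)
      have h3 := (hx' (i + 1)).2
      simp only [right] at h1 h2 h3 hxρ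
      linarith [hball.1]
    · have hip : i + 1 ≤ p := by
        by_contra! hcon
        have := hblock (i + 1) (by simp only [Finset.mem_Icc]; omega)
        have := (hw' (i + 1) (by omega)).2
        omega
      have h1 := right_add_le_left (by linarith) hsep hw hw' hag hlt
      have h2 := hw.right_antitone hip
      have h3 := (hx' (i + 1)).1
      have h4 := s_add_lt (K := K) hl2 p
      have h5 := mul_le_mul_of_nonneg_left (K.s_antitone hip) (show 0 ≤ c - 1 by linarith)
      simp only at h2
      linarith [hball.2, hx.2]
  refine ⟨hag, ?_, (hw' _ (by omega)).2⟩
  by_contra! hcon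
  have h1 := (hx' (p + l + 1)).2
  rw [right, left_succ, ← hag.left_eq] at h1
  have h2 := mul_le_mul_of_nonneg_right (d_mono (K := K) (n := p + l + 1) (by omega)
    (hw' _ (by omega)).1 (Nat.lt_succ_iff.1 hcon) hkm.le) hs.le
  rw [right] at hxρ
  linarith [hball.1]

/-- The block copies the code of a point of C almost nearest to the midpoint of `[a, b]`. In any
interval of order `n` it yields a translated centre, up to a small error, whose shrunken ball stays
strictly between children `j₁` and `j₂`. -/
theorem ofReal_le_packingMeasure_of_central {M : ℕ} (hM : ∀ n, 1 ≤ n → K.m n ≤ M) {c : ℝ}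
    (hc : 1 < c) (hsep : ∀ n, 1 ≤ n → ∀ j, 1 ≤ j → j < K.m n → c ≤ K.d n (j + 1) - K.d n j)
    {τ : ℕ → ℕ} (hτ : K.IsWord τ)
    {t h h' : ℝ} (ht1 : t ≤ 1) (h0 : 0 ≤ h) (hh : h < h')
    (hfreq : ∃ᶠ n in atTop, ∃ j₁ j₂ a b, 1 ≤ j₁ ∧ j₁ + 1 < j₂ ∧ j₂ ≤ K.m (n + 1) ∧
      a = K.left n τ + (K.d (n + 1) j₁ + 1) * K.s (n + 1) ∧
      b = K.left n τ + K.d (n + 1) j₂ * K.s (n + 1) ∧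
      h' * ((j₂ - j₁ - 1) / K.mu (n + 1))
        ≤ (b - a - 2 * Metric.infDist ((a + b) / 2) K.cantorSet) ^ t) :
    ENNReal.ofReal h ≤ packingMeasure t K.cantorSet := by
  obtain ⟨η, hη0, hη1, hη⟩ := exists_shrink h0 hh
  obtain ⟨l, hl, -⟩ := exists_two_pow (show 0 < η / 2 * (c - 1) from
    mul_pos (by linarith) (by linarith)) hη0
  refine ofReal_le_packingMeasure hM (l + 1) (hfreq.mono ?_)
  rintro n ⟨j₁, j₂, a, b, hj1, hj12, hj2, ha, hb, hk⟩
  have hs := K.s_pos (n + 1)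
  have hsn := K.s_eq n
  have hn1 : 1 ≤ n + 1 := by omega
  set D := Metric.infDist ((a + b) / 2) K.cantorSet with hD
  have hsep' := hsep (n + 1) hn1
  -- A point of child `j₁ + 1` is at distance at least `(c - 1) * K.s (n + 1)` from both `a` and
  -- `b`; this makes the radius comparable to `K.s (n + 1)`.
  have hρ0 : (c - 1) * K.s (n + 1) ≤ (b - a) / 2 - D := by
    have hv := hτ.update (n := n + 1) (k := j₁ + 1) (by omega) (by omega)
    have h1 := hv.codes_point.2 (n + 1)
    rw [left_update, right_update] at h1
    have h2 : D ≤ |(a + b) / 2 - K.point (Function.update τ (n + 1) (j₁ + 1))| := by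
      rw [← Real.dist_eq]
      exact Metric.infDist_le_dist_of_mem hv.codes_point.mem_cantorSet
    have h3 := mul_le_mul_of_nonneg_right (d_add_le (show 0 ≤ c by linarith) hsep' hj1
      (Nat.lt_succ_self _) (by omega)) hs.le
    have h4 := mul_le_mul_of_nonneg_right (d_add_le (show 0 ≤ c by linarith) hsep'
      (show 1 ≤ j₁ + 1 by omega) hj12 hj2) hs.le
    rcases abs_cases ((a + b) / 2 - K.point (Function.update τ (n + 1) (j₁ + 1))) with h5 | h5 <;>
      rw [h5.1] at h2 <;> linarith [h1.1, h1.2]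
  have hD0 : 0 ≤ D := Metric.infDist_nonneg
  have hal : K.left n τ ≤ a := by
    have := d_nonneg (K := K) hn1 hj1 (by omega)
    rw [ha]; nlinarith
  have hbr : b ≤ K.left n τ + K.s n := by
    have := d_mono (K := K) hn1 (show 1 ≤ j₂ by omega) hj2 le_rfl
    rw [hb, hsn]; nlinarith
  set ρ := (b - a) / 2 - D with hρ
  have hρpos : 0 < ρ := (mul_pos (by linarith) hs).trans_le hρ0
  have hρη : 0 < η * ρ := mul_pos hη0 hρpos
  -- Half of the margin `η * ρ` goes to approximating the infimum, the other half to the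
  -- unprescribed tail of `w`.
  obtain ⟨x, hxC, hxD⟩ := (Metric.infDist_lt_iff ⟨_, hτ.codes_point.mem_cantorSet⟩).1
    (show D < D + η * ρ / 2 by linarith)
  obtain ⟨u, hu⟩ := exists_codes hxC
  rw [dist_comm, Real.dist_eq, abs_lt] at hxD
  have huτ : Agree n u τ := agree_of_mem hu.1 hτ (hu.2 n) (by
    rw [right]; constructor <;> nlinarith)
  refine ⟨u, hu.1, fun w hw hblock => ?_⟩
  have hshift : ∀ j ≤ l + 1, K.left (n + j) w - K.left n w = K.left (n + j) u - K.left n u := by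
    intro j hj
    induction j with
    | zero => simp
    | succ j ih =>
      rw [← add_assoc, left_succ, left_succ,
        hblock (n + j + 1) (by simp only [Finset.mem_Icc]; omega)]
      linarith [ih (by omega)]
  have hsh := hshift (l + 1) le_rfl
  have hxw := hw.codes_point.2 (n + (l + 1))
  have hxu := hu.2 (n + (l + 1))
  rw [right] at hxw hxu
  have hsl := s_add_lt (K := K) hl (n + 1)
  rw [show n + 1 + l = n + (l + 1) by ring] at hsl
  have hsl' : K.s (n + (l + 1)) < η * ρ / 2 := by nlinarith
  have hlu := huτ.left_eq (K := K)
  refine ⟨(1 - η) * ρ, mul_pos (by linarith) hρpos, by nlinarith, ?_⟩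
  have hcount : ((j₂ : ℝ) - j₁ - 1) / K.mu (n + 1)
      = (((j₂ - 1 : ℕ) : ℝ) - (j₁ + 1 : ℕ) + 1) / K.mu (n + 1) := by
    rw [Nat.cast_sub (by omega)]
    congr 1; push_cast; ring
  have hj12' : (j₁ : ℝ) + 1 ≤ j₂ := by exact_mod_cast hj12.le
  refine mul_le_shrink_rpow ht1 hη0 hη1 h0 hρpos.le hη (q := (j₂ - j₁ - 1) / K.mu (n + 1))
    ?_ ?_ (div_nonneg (by linarith) (by positivity))
  · convert hk using 2
    rw [hρ]; ring
  rw [hcount]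
  refine cantorMeasure_le hw (by omega) (by omega) (by omega)
    Metric.isClosed_closedBall.measurableSet ?_
  intro w' hw' hball
  rw [Real.closedBall_eq_Icc] at hball
  have hx' := hw'.codes_point.2
  have hlow : K.left n w + (K.d (n + 1) j₁ + 1) * K.s (n + 1) < K.point w' := by
    have : K.left n w + (K.d (n + 1) j₁ + 1) * K.s (n + 1) = a + K.left n w - K.left n τ := by
      rw [ha]; ring
    rw [this]
    linarith [hball.1, hxD.1, hxw.1, hxu.2]
  have hupp : K.point w' < K.left n w + K.d (n + 1) j₂ * K.s (n + 1) := by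
    have : K.left n w + K.d (n + 1) j₂ * K.s (n + 1) = b + K.left n w - K.left n τ := by
      rw [hb]; ring
    rw [this]
    linarith [hball.2, hxD.2, hxw.2, hxu.1]
  have hag : Agree n w w' := agree_of_mem hw hw' (by
    rw [right]; constructor <;> linarith) (hx' n)
  have hx1 := hx' (n + 1)
  rw [right, left_succ, ← hag.left_eq] at hx1
  have hw1 := hw' (n + 1) hn1
  refine ⟨hag, ?_, ?_⟩
  · by_contra! hcon
    have := mul_le_mul_of_nonneg_right (d_mono (K := K) hn1 hw1.1 (Nat.lt_succ_iff.1 hcon)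
      (by omega)) hs.le
    linarith [hx1.2]
  · by_contra! hcon
    have := mul_le_mul_of_nonneg_right (d_mono (K := K) hn1 (show 1 ≤ j₂ by omega)
      (show j₂ ≤ w' (n + 1) by omega) hw1.2) hs.le
    linarith [hx1.1]

/-! ### The exponent and the three ratios -/

theorem log_mu_div_mem (n : ℕ) : Real.log (K.mu n) / |Real.log (K.s n)| ∈ Icc (0 : ℝ) 1 := by
  have hs := K.s_pos n
  have hmu : (0 : ℝ) < K.mu n := by exact_mod_cast K.mu_pos n
  have h1 : Real.log (K.mu n) + Real.log (K.s n) ≤ 0 := by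
    rw [← Real.log_mul hmu.ne' hs.ne']
    exact Real.log_nonpos (by positivity) (K.mu_mul_s_le_one n)
  refine ⟨div_nonneg (Real.log_natCast_nonneg _) (abs_nonneg _),
    div_le_one_of_le₀ ?_ (abs_nonneg _)⟩
  linarith [neg_le_abs (Real.log (K.s n))]

theorem dimP_nonneg : 0 ≤ K.dimP :=
  le_limsup_of_frequently_le (Frequently.of_forall fun n => (log_mu_div_mem n).1)
    ⟨1, eventually_map.2 (Eventually.of_forall fun n => (log_mu_div_mem n).2)⟩

theorem dimP_le_one : K.dimP ≤ 1 :=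
  limsup_le_of_le (IsBoundedUnder.isCoboundedUnder_le
    ⟨0, eventually_map.2 (Eventually.of_forall fun n => (log_mu_div_mem n).1)⟩)
    (Eventually.of_forall fun n => (log_mu_div_mem n).2)

theorem mu_div_mul_le_iff {n : ℕ} {q x A : ℝ} (hq : 0 < q) :
    (K.mu n : ℝ) / q * x ≤ A ↔ x ≤ A * (q / K.mu n) := by
  have hmu : (0 : ℝ) < K.mu n := by exact_mod_cast K.mu_pos n
  rw [← mul_div_assoc, le_div_iff₀ hmu, div_mul_eq_mul_div, div_le_iff₀ hq, mul_comm]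

theorem alphaSeq_le_iff {n : ℕ} {A : ℝ} (hA : 0 ≤ A) :
    K.alphaSeq (n + 1) ≤ ENNReal.ofReal A ↔ ∀ k, 1 ≤ k → k < K.m (n + 1) →
      (K.d (n + 1) (k + 1) * K.s (n + 1)) ^ K.dimP ≤ A * (k / K.mu (n + 1)) := by
  have hm := K.two_le_m (n + 1) (by omega)
  simp only [alphaSeq, iSup_le_iff, Finset.mem_Icc, ENNReal.ofReal_le_ofReal_iff hA]
  have h : ∀ k : ℕ, 1 ≤ k → (k : ℝ) * K.s (n + 1) + ∑ i ∈ Finset.Icc 1 k, K.gap (n + 1) i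
      = K.d (n + 1) (k + 1) * K.s (n + 1) := by
    intro k hk
    have := sum_gap_Icc (K := K) (n := n + 1) (show 1 ≤ k + 1 by omega)
    rwa [Nat.add_sub_cancel, K.d_first _ (by omega), sub_zero] at this
  refine forall_congr' fun k => ⟨fun h1 hk1 hk2 => ?_, fun h1 hk => ?_⟩
  · rw [← h k hk1, ← mu_div_mul_le_iff (by exact_mod_cast hk1)]
    exact h1 ⟨hk1, by omega⟩
  · rw [h k hk.1, mu_div_mul_le_iff (by exact_mod_cast hk.1)]
    exact h1 hk.1 (by omega)

theorem betaSeq_le_iff {n : ℕ} {A : ℝ} (hA : 0 ≤ A) :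
    K.betaSeq (n + 1) ≤ ENNReal.ofReal A ↔ ∀ k, 1 ≤ k → k < K.m (n + 1) →
      (K.s n - (K.d (n + 1) k + 1) * K.s (n + 1)) ^ K.dimP
        ≤ A * ((K.m (n + 1) - k) / K.mu (n + 1)) := by
  simp only [betaSeq, iSup_le_iff, Finset.mem_Icc, ENNReal.ofReal_le_ofReal_iff hA]
  have h : ∀ k, k < K.m (n + 1) → (((K.m (n + 1) : ℝ) - (k + 1 : ℕ) + 1) * K.s (n + 1) +
        ∑ i ∈ Finset.Icc (k + 1 - 1) (K.m (n + 1) - 1), K.gap (n + 1) i)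
      = K.s n - (K.d (n + 1) k + 1) * K.s (n + 1) := by
    intro k hk
    have := sum_gap_Icc (K := K) (n := n + 1) hk.le
    have e : Finset.Icc (k + 1 - 1) (K.m (n + 1) - 1) = Finset.Ico k (K.m (n + 1)) := by
      ext i; simp only [Finset.mem_Icc, Finset.mem_Ico]; omega
    rw [Nat.cast_sub hk.le] at this
    rw [e, K.s_eq n]
    push_cast
    linarith
  have hc : ∀ k : ℕ, (K.m (n + 1) : ℝ) - (k + 1 : ℕ) + 1 = K.m (n + 1) - k := fun k => by
    push_cast; ring
  have hpos : ∀ k, k < K.m (n + 1) → (0 : ℝ) < K.m (n + 1) - k := fun k hk =>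
    sub_pos.2 (by exact_mod_cast hk)
  constructor
  · intro h1 k hk1 hk2
    have := h1 (k + 1) ⟨by omega, by omega⟩
    rwa [h k hk2, hc, mu_div_mul_le_iff (hpos k hk2)] at this
  · intro h1 k hk
    obtain ⟨j, rfl⟩ : ∃ j, k = j + 1 := ⟨k - 1, by omega⟩
    rw [h j (by omega), hc, mu_div_mul_le_iff (hpos j (by omega))]
    exact h1 j (by omega) (by omega)

/-- Here `j₁ = k₁ - 1` and `j₂ = k₂ + 1` are the children bordering the block. -/
theorem gammaSeq_le_iff {τ : ℕ → ℕ} {n : ℕ} {A : ℝ} (hA : 0 ≤ A) :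
    K.gammaSeq τ (n + 1) ≤ ENNReal.ofReal A ↔
      ∀ j₁ j₂ a b, 1 ≤ j₁ → j₁ + 1 < j₂ → j₂ ≤ K.m (n + 1) →
      a = K.left n τ + (K.d (n + 1) j₁ + 1) * K.s (n + 1) →
      b = K.left n τ + K.d (n + 1) j₂ * K.s (n + 1) →
      (b - a - 2 * Metric.infDist ((a + b) / 2) K.cantorSet) ^ K.dimP
        ≤ A * ((j₂ - j₁ - 1) / K.mu (n + 1)) := by
  simp only [gammaSeq, iSup_le_iff, Finset.mem_Icc, ENNReal.ofReal_le_ofReal_iff hA, midDist, aPt,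
    bPt, left_update, right_update]
  have hc : ∀ j₁ j₂ : ℕ, (j₂ : ℝ) - (j₁ + 1 : ℕ) + 1 = (j₂ + 1 : ℕ) - j₁ - 1 := fun j₁ j₂ => by
    push_cast; ring
  have hpos : ∀ j₁ j₂ : ℕ, j₁ + 1 < j₂ + 1 → (0 : ℝ) < (j₂ + 1 : ℕ) - j₁ - 1 := fun j₁ j₂ h => by
    have : (j₁ : ℝ) + 1 < (j₂ + 1 : ℕ) := by exact_mod_cast h
    linarith
  constructor
  · rintro h1 j₁ j₂ a b hj1 hj hj2 rfl rfl
    obtain ⟨j, rfl⟩ : ∃ j, j₂ = j + 1 := ⟨j₂ - 1, by omega⟩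
    have := h1 (j₁ + 1) ⟨by omega, by omega⟩ j ⟨by omega, by omega⟩
    rwa [hc, mu_div_mul_le_iff (hpos _ _ hj), Nat.add_sub_cancel] at this
  · intro h1 k₁ hk1 k₂ hk2
    obtain ⟨j, rfl⟩ : ∃ j, k₁ = j + 1 := ⟨k₁ - 1, by omega⟩
    rw [hc, mu_div_mul_le_iff (hpos _ _ (by omega)), Nat.add_sub_cancel]
    exact h1 j (k₂ + 1) _ _ (by omega) (by omega) (by omega) rfl rfl

/-- The parts of the Cantor set in two basic intervals of the same order are translates. -/
theorem Codes.translate {w τ : ℕ → ℕ} {x : ℝ} (hx : K.Codes w x) (hτ : K.IsWord τ) (n : ℕ) :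
    x - K.left n w + K.left n τ ∈ K.cantorSet := by
  let v : ℕ → ℕ := fun i => if i ≤ n then τ i else w i
  have hv : K.IsWord v := by
    intro i hi
    by_cases h : i ≤ n
    · simpa [v, h] using hτ i hi
    · simpa [v, h] using hx.1 i hi
  have hvτ : Agree n v τ := fun i _ hi => by simp [v, hi]
  have hleft : ∀ j, K.left (n + j) v = K.left (n + j) w - K.left n w + K.left n τ := by
    intro j
    induction j with
    | zero => simp [hvτ.left_eq]
    | succ j ih =>
      rw [← add_assoc, left_succ, left_succ, ih, show v (n + j + 1) = w (n + j + 1) by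
        simp [v, show ¬ n + j + 1 ≤ n by omega]]
      ring
  refine Codes.mem_cantorSet (w := v) ⟨hv, fun k => ?_⟩
  have h1 := hx.2 (n + k)
  have h2 := hleft k
  have h3 := hv.left_mono (show k ≤ n + k by omega)
  have h4 := hv.right_antitone (show k ≤ n + k by omega)
  simp only [right] at h1 h3 h4 ⊢
  exact ⟨by linarith [h1.1], by linarith [h1.2]⟩

/-- Twice the distance from a point of `[a, b]` to the nearer end is b - a minus twice its distance
to the midpoint. Translating into the interval of `τ` bounds the latter below by the distance from
C, so γ does not depend on where the ball sits. -/
theorem two_mul_min_le {τ w : ℕ → ℕ} (hτ : K.IsWord τ) {n : ℕ} {x u v : ℝ} (hx : K.Codes w x) :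
    2 * min (x - (K.left n w + u)) (K.left n w + v - x) ≤
      K.left n τ + v - (K.left n τ + u)
        - 2 * Metric.infDist ((K.left n τ + u + (K.left n τ + v)) / 2) K.cantorSet := by
  have h := Metric.infDist_le_dist_of_mem (x := (K.left n τ + u + (K.left n τ + v)) / 2)
    (hx.translate hτ n)
  rw [Real.dist_eq] at h
  rcases abs_cases ((K.left n τ + u + (K.left n τ + v)) / 2 - (x - K.left n w + K.left n τ))
    with h1 | h1 <;> rw [h1.1] at h
  · linarith [min_le_left (x - (K.left n w + u)) (K.left n w + v - x)]
  · linarith [min_le_right (x - (K.left n w + u)) (K.left n w + v - x)]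

/-! ### The two inequalities -/

theorem two_rpow_eq (t : ℝ) : (2 : ℝ≥0∞) ^ t = ENNReal.ofReal (2 ^ t) := by
  rw [← ENNReal.ofReal_rpow_of_pos two_pos, ENNReal.ofReal_ofNat]

theorem packingMeasure_cantorSet_le {τ : ℕ → ℕ} (hτ : K.IsWord τ) :
    packingMeasure K.dimP K.cantorSet ≤
      max (max (2 ^ K.dimP * K.alpha) (2 ^ K.dimP * K.beta)) (K.gamma τ) := by
  refine le_of_forall_gt_imp_ge_of_dense fun y hy => ?_
  obtain ⟨H, hH, hHy⟩ := ENNReal.lt_iff_exists_nnreal_btwn.1 hy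
  refine le_trans ?_ hHy.le
  have h2t : (0 : ℝ) < 2 ^ K.dimP := by positivity
  have hdiv : ENNReal.ofReal (H / 2 ^ K.dimP) = H / 2 ^ K.dimP := by
    rw [ENNReal.ofReal_div_of_pos h2t, two_rpow_eq, ENNReal.ofReal_coe_nnreal]
  have hlt : ∀ a : ℝ≥0∞, 2 ^ K.dimP * a < H → a < ENNReal.ofReal (H / 2 ^ K.dimP) := by
    intro a ha
    rw [hdiv, ENNReal.lt_div_iff_mul_lt (Or.inl ?_) (Or.inl ?_), mul_comm]
    · exact ha
    · rw [two_rpow_eq]; simpa using h2t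
    · rw [two_rpow_eq]; simp
  set A : ℝ := H / 2 ^ K.dimP with hAdef
  have hA : 0 ≤ A := by positivity
  have hHA : 2 ^ K.dimP * A = H := mul_div_cancel₀ _ h2t.ne'
  have h1 := eventually_lt_of_limsup_lt
    (hlt _ (((le_max_left _ _).trans (le_max_left _ _)).trans_lt hH))
  have h2 := eventually_lt_of_limsup_lt
    (hlt _ (((le_max_right _ _).trans (le_max_left _ _)).trans_lt hH))
  have h3 := eventually_lt_of_limsup_lt ((le_max_right _ _).trans_lt hH)
  rw [eventually_inf_principal] at h3
  obtain ⟨N, hN⟩ := eventually_atTop.1 (h1.and (h2.and h3))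
  have hα := fun n (hn : N ≤ n) => (alphaSeq_le_iff hA).1 (hN (n + 1) (by omega)).1.le
  have hβ := fun n (hn : N ≤ n) => (betaSeq_le_iff hA).1 (hN (n + 1) (by omega)).2.1.le
  -- If t = 0, the α-bound with `k = 1` says μ(n) ≤ A for large n, against μ(n) ≥ 2^n.
  have ht0 : 0 < K.dimP := by
    refine dimP_nonneg.lt_of_ne fun h0 => ?_
    obtain ⟨n, hn⟩ := pow_unbounded_of_one_lt A one_lt_two
    have h4 := hα (N + n) (by omega) 1 le_rfl (K.two_le_m _ (by omega))
    have hmu : (0 : ℝ) < K.mu (N + n + 1) := by exact_mod_cast K.mu_pos _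
    rw [← h0, Real.rpow_zero, Nat.cast_one, mul_one_div, le_div_iff₀ hmu, one_mul] at h4
    have h5 : (2 : ℝ) ^ n ≤ K.mu (N + n + 1) := by
      exact_mod_cast (Nat.pow_le_pow_right two_pos (by omega)).trans (K.two_pow_le_mu (N + n + 1))
    linarith
  rw [← ENNReal.ofReal_coe_nnreal]
  refine packingMeasure_le (ν := K.cantorMeasure) (δ := K.s N / 2) (half_pos (K.s_pos N)) H.2 ?_
  intro x hx ρ hρ hρN
  rw [Real.closedBall_eq_Icc, ← hHA]
  refine two_mul_rpow_le ht0 dimP_le_one hA hα hβ ?_ hx hρ (by linarith [K.s_pos N])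
  intro n hn w x hwx j₁ j₂ hj1 hj hj2 hlow hupp
  rw [hHA]
  have h4 := (hN (n + 1) (by omega)).2.2 (show 3 ≤ K.m (n + 1) by omega)
  rw [← ENNReal.ofReal_coe_nnreal] at h4
  refine (Real.rpow_le_rpow (mul_nonneg zero_le_two (le_min ?_ ?_)) (two_mul_min_le hτ hwx)
    ht0.le).trans ((gammaSeq_le_iff H.2).1 h4.le j₁ j₂ _ _ hj1 hj hj2 rfl rfl)
  · linarith
  · linarith

theorem le_packingMeasure_of_forall_lt {X Y : ℝ≥0∞}
    (h : ∀ a b : ℝ, 0 ≤ a → a < b → ENNReal.ofReal b < X → ENNReal.ofReal a ≤ Y) : X ≤ Y := by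
  refine ENNReal.le_of_forall_nnreal_lt fun a ha => ?_
  obtain ⟨b, hab, hb⟩ := ENNReal.lt_iff_exists_nnreal_btwn.1 ha
  rw [← ENNReal.ofReal_coe_nnreal] at hb ⊢
  exact h a b a.2 (by exact_mod_cast hab) hb

theorem ofReal_div_lt {b t : ℝ} {a : ℝ≥0∞} (h : ENNReal.ofReal b < 2 ^ t * a) :
    ENNReal.ofReal (b / 2 ^ t) < a := by
  rw [ENNReal.ofReal_div_of_pos (by positivity), ← two_rpow_eq]
  exact ENNReal.div_lt_of_lt_mul' h

theorem frequently_succ {Q : ℕ → Prop} (h : ∃ᶠ n in atTop, Q n) : ∃ᶠ n in atTop, Q (n + 1) :=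
  frequently_add h 1

theorem alpha_le_packingMeasure {M : ℕ} (hM : ∀ n, 1 ≤ n → K.m n ≤ M) {c : ℝ}
    (hc : 1 < c) (hsep : ∀ n, 1 ≤ n → ∀ j, 1 ≤ j → j < K.m n → c ≤ K.d n (j + 1) - K.d n j) :
    2 ^ K.dimP * K.alpha ≤ packingMeasure K.dimP K.cantorSet := by
  refine le_packingMeasure_of_forall_lt fun a b ha hab hb => ?_
  refine ofReal_le_packingMeasure_of_left hM hc hsep dimP_le_one ha hab ?_
  have h2t : (0 : ℝ) < 2 ^ K.dimP := by positivity
  refine (frequently_succ (frequently_lt_of_lt_limsup (h := ofReal_div_lt hb))).mono fun n hn => ?_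
  rw [← not_le, alphaSeq_le_iff (div_nonneg (by linarith) h2t.le)] at hn
  push Not at hn
  obtain ⟨k, hk1, hkm, hk⟩ := hn
  refine ⟨k, hk1, hkm, ?_⟩
  rw [Real.mul_rpow zero_le_two (mul_nonneg (d_nonneg (by omega) (by omega) hkm) (K.s_pos _).le)]
  rw [div_mul_eq_mul_div, div_lt_iff₀ h2t] at hk
  linarith

theorem beta_le_packingMeasure {M : ℕ} (hM : ∀ n, 1 ≤ n → K.m n ≤ M) {c : ℝ}
    (hc : 1 < c) (hsep : ∀ n, 1 ≤ n → ∀ j, 1 ≤ j → j < K.m n → c ≤ K.d n (j + 1) - K.d n j) :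
    2 ^ K.dimP * K.beta ≤ packingMeasure K.dimP K.cantorSet := by
  refine le_packingMeasure_of_forall_lt fun a b ha hab hb => ?_
  refine ofReal_le_packingMeasure_of_right hM hc hsep dimP_le_one ha hab ?_
  have h2t : (0 : ℝ) < 2 ^ K.dimP := by positivity
  refine (frequently_succ (frequently_lt_of_lt_limsup (h := ofReal_div_lt hb))).mono fun n hn => ?_
  rw [← not_le, betaSeq_le_iff (div_nonneg (by linarith) h2t.le)] at hn
  push Not at hn
  obtain ⟨k, hk1, hkm, hk⟩ := hn
  refine ⟨k, hk1, hkm, ?_⟩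
  have hd := d_mono (K := K) (n := n + 1) (by omega) hk1 hkm.le le_rfl
  rw [Real.mul_rpow zero_le_two (by rw [K.s_eq n]; nlinarith [K.s_pos (n + 1)])]
  rw [div_mul_eq_mul_div, div_lt_iff₀ h2t] at hk
  linarith

theorem gamma_le_packingMeasure {M : ℕ} (hM : ∀ n, 1 ≤ n → K.m n ≤ M) {c : ℝ}
    (hc : 1 < c) (hsep : ∀ n, 1 ≤ n → ∀ j, 1 ≤ j → j < K.m n → c ≤ K.d n (j + 1) - K.d n j)
    {τ : ℕ → ℕ} (hτ : K.IsWord τ) :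
    K.gamma τ ≤ packingMeasure K.dimP K.cantorSet := by
  refine le_packingMeasure_of_forall_lt fun a b ha hab hb => ?_
  refine ofReal_le_packingMeasure_of_central hM hc hsep hτ dimP_le_one ha hab ?_
  have hfreq : ∃ᶠ n in atTop, ENNReal.ofReal b < K.gammaSeq τ n :=
    (frequently_lt_of_lt_limsup (h := hb)).filter_mono inf_le_left
  refine (frequently_succ hfreq).mono fun n hn => ?_
  rw [← not_le, gammaSeq_le_iff (by linarith)] at hn
  push Not at hn
  obtain ⟨j₁, j₂, u, v, hj1, hj, hj2, hu, hv, hk⟩ := hn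
  exact ⟨j₁, j₂, u, v, hj1, hj, hj2, hu, hv, hk.le⟩

end CantorData

theorem mainTheorem2 (K : CantorData) (M : ℕ) (hM : ∀ n, 1 ≤ n → K.m n ≤ M)
    (c : ℝ) (hc : 1 < c)
    (hsep : ∀ n, 1 ≤ n → ∀ j, 1 ≤ j → j < K.m n → c ≤ K.d n (j + 1) - K.d n j)
    (τ : ℕ → ℕ) (hτ : K.IsWord τ) :
    packingMeasure K.dimP K.cantorSet =
      max (max (2 ^ K.dimP * K.alpha) (2 ^ K.dimP * K.beta)) (K.gamma τ) :=
  le_antisymm (CantorData.packingMeasure_cantorSet_le hτ)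
    (max_le (max_le (CantorData.alpha_le_packingMeasure hM hc hsep)
      (CantorData.beta_le_packingMeasure hM hc hsep))
      (CantorData.gamma_le_packingMeasure hM hc hsep hτ))
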